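/- Let $X_1,X_2,\ldots$ be independent $N(\xi,\sigma^2)$ random variables with $\xi\neq0$ and $\sigma>0$ (both unknown). For $n\ge2$ put $\bar X_n=\frac1n\sum_{i=1}^nX_i$ and $\widehat\sigma_n^2=\frac1{n-1}\sum_{i=1}^n(X_i-\bar X_n)^2$, and for $d\in\mathbb R$ consider the estimator $\theta_n^*(d)=(\bar X_n)^2-d\,\widehat\sigma_n^2/n$ of $\xi^2$. Let $a(\varepsilon)$ be any function with $a(\varepsilon)\to0$ and $a(\varepsilon)/\varepsilon^2\to\infty$ as $\varepsilon\to0^+$ (for example $a(\varepsilon)=\varepsilon$), and let $Q^*_\varepsilon(d)$ be the number of integers $n\ge 2$ with $n\ge a(\varepsilon)/\varepsilon^2$ and $|\theta_n^*(d)-\xi^2|\ge\varepsilon$. Then, for every $d$ and every $\varepsilon>0$, $Q^*_\varepsilon(d)$ is almost surely finite and has finite expectation, and for every $d\in\mathbb R$ $$\lim_{\varepsilon\to0^+}\mathrm E\{Q^*_\varepsilon(d)-Q^*_\varepsilon(0)\}=\bigl(\tfrac14d^2+\tfrac12d\bigr)\frac{\sigma^2}{\xi^2}.$$ Consequently the estimator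 $(\bar X_n)^2+\widehat\sigma_n^2/n$, i.e. $d=-1$, is the unique best one in this class: the limit above is strictly smaller at $d=-1$ than at any other $d$, and for every $d\neq-1$ $$\lim_{\varepsilon\to0^+}\mathrm E\{Q^*_\varepsilon(d)-Q^*_\varepsilon(-1)\}=\tfrac14(d+1)^2\,\frac{\sigma^2}{\xi^2}>0,$$ so that $\mathrm E\,Q^*_\varepsilon(-1)<\mathrm E\,Q^*_\varepsilon(d)$ for all sufficiently small $\varepsilon>0$. -/

import Mathlib

open MeasureTheory ProbabilityTheory Filter Topology
open scoped NNReal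

/-- The mean of the first `n` observations `x 0, …, x (n - 1)`. -/
noncomputable def sampleMean (x : ℕ → ℝ) (n : ℕ) : ℝ :=
  (∑ i ∈ Finset.range n, x i) / (n : ℝ)

/-- The unbiased variance estimate from the first `n ≥ 2` observations. -/
noncomputable def sampleVar (x : ℕ → ℝ) (n : ℕ) : ℝ :=
  (∑ i ∈ Finset.range n, (x i - sampleMean x n) ^ 2) / ((n : ℝ) - 1)

/-- The estimator `(sample mean)² - d * (sample variance) / n` of the squared mean. -/
noncomputable def sqMeanEstimator (d : ℝ) (x : ℕ → ℝ) (n : ℕ) : ℝ :=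
  sampleMean x n ^ 2 - d * sampleVar x n / (n : ℝ)

/-- The sample sizes `n ≥ N` at which the estimator with constant `d` misses the target `θ`
by at least `ε`. Only `n ≥ 2` is considered, since the variance estimate needs two observations. -/
def missSet (d θ ε N : ℝ) (x : ℕ → ℝ) : Set ℕ :=
  {n : ℕ | 2 ≤ n ∧ N ≤ (n : ℝ) ∧ ε ≤ |sqMeanEstimator d x n - θ|}

/-- The number of `ε`-misses (meaningful when `missSet` is finite). -/
noncomputable def missCount (d θ ε N : ℝ) (x : ℕ → ℝ) : ℝ :=
  ((missSet d θ ε N x).ncard : ℝ)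

/-!
Write `X i = ξ + τ ξ Y i` with `τ = σ / |ξ|` and `Y` a standard normal sample, and put
`κ = ε / (2 τ ξ²)`. The error of the estimator at sample size `n` is
`(2 τ ξ² / √n) (Z + b (Z² - d W))` with `b = τ / (2 √n)`, where `Z = √n · mean Y` is standard normal
and independent of the sample variance `W` of `Y`. A miss is therefore the event
`u ≤ |Z + b (Z² - s)|` with `u = κ √n` and `s = d W`, and its probability can be computed
conditionally on `W`.

Solving the quadratic for `Z` and expanding in `b`, the two tails contribute opposite terms of first
order, so that replacing `s = 0` by `s` changes the probability by
`b² φ(u) u (s² + 4 s - 2 u² s) + O(b³)`, uniformly in `u`. Since `E W = 1` and `Var W = O(1 / n)`,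
averaging over `W` gives `(τ² / 2) κ² g(κ² n) + O(n ^ (-3 / 2))` for an explicit function `g`. The
remainders are summable in `n` uniformly in `κ`, and the smallest counted size `N` tends to infinity
while `κ² N` tends to `0`. Hence the sum over `n ≥ N` is a Riemann sum converging to
`(τ² / 2) ∫₀^∞ g = (d² / 4 + d / 2) τ²`.
-/

local notation "γ" => gaussianReal 0 1
local notation "φ" => gaussianPDFReal 0 1

section Density

lemma hasDerivAt_gaussianPDFReal (μ : ℝ) (v : ℝ≥0) (x : ℝ) :
    HasDerivAt (gaussianPDFReal μ v) (-(x - μ) / v * gaussianPDFReal μ v x) x := by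
  have hexponent : HasDerivAt (fun x : ℝ => -(x - μ) ^ 2 / (2 * v)) (-(x - μ) / v) x := by
    convert! ((((hasDerivAt_id x).sub_const μ).pow 2).neg).div_const (2 * (v : ℝ)) using 1
    rw [← mul_div_mul_left (-(x - μ)) (v : ℝ) two_ne_zero]
    simp only [id_eq]
    ring
  convert! (hexponent.exp).const_mul (√(2 * Real.pi * v))⁻¹ using 1
  simp only [gaussianPDFReal]
  ring

lemma continuous_gaussianPDFReal (μ : ℝ) (v : ℝ≥0) : Continuous (gaussianPDFReal μ v) :=
  continuous_iff_continuousAt.2 fun x => (hasDerivAt_gaussianPDFReal μ v x).continuousAt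

lemma stdGaussianPDF_eq_mul_exp (x y : ℝ) : φ y = φ x * Real.exp ((x ^ 2 - y ^ 2) / 2) := by
  simp only [gaussianPDFReal, sub_zero, NNReal.coe_one, mul_one, mul_assoc, ← Real.exp_add]
  ring_nf

lemma stdGaussianPDF_mul_one_add_abs_pow_le (x : ℝ) (k : ℕ) :
    φ x * (1 + |x|) ^ k ≤ k.factorial * Real.exp 2 := by
  have hconst : (√(2 * Real.pi))⁻¹ ≤ 1 :=
    inv_le_one_of_one_le₀ (Real.one_le_sqrt.2 (by linarith [Real.pi_gt_three]))
  have hpow : (1 + |x|) ^ k ≤ k.factorial * Real.exp (1 + |x|) := by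
    have := Real.pow_div_factorial_le_exp (1 + |x|) (by positivity) k
    rwa [div_le_iff₀' (by positivity)] at this
  calc φ x * (1 + |x|) ^ k
      ≤ (1 * Real.exp (-x ^ 2 / 2)) * (k.factorial * Real.exp (1 + |x|)) := by
        simp only [gaussianPDFReal, sub_zero, NNReal.coe_one, mul_one]
        gcongr
    _ = k.factorial * Real.exp (-x ^ 2 / 2 + (1 + |x|)) := by
        rw [Real.exp_add _ (1 + |x|)]; ring
    _ ≤ k.factorial * Real.exp 2 := by
        gcongr
        nlinarith [sq_nonneg (|x| - 1), sq_abs x]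

end Density

section Distribution

lemma hasDerivAt_cdf_gaussianReal (μ : ℝ) {v : ℝ≥0} (hv : v ≠ 0) (x : ℝ) :
    HasDerivAt (cdf (gaussianReal μ v)) (gaussianPDFReal μ v x) x := by
  have hcdf : ∀ y, cdf (gaussianReal μ v) y = ∫ t in Set.Iic y, gaussianPDFReal μ v t := by
    intro y
    rw [cdf_eq_real, measureReal_def, gaussianReal_apply_eq_integral μ hv,
      ENNReal.toReal_ofReal (integral_nonneg fun t => gaussianPDFReal_nonneg _ _ _)]
  have hprim : ⇑(cdf (gaussianReal μ v)) = fun y =>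
      (∫ t in Set.Iic (0 : ℝ), gaussianPDFReal μ v t) +
        ∫ t in (0 : ℝ)..y, gaussianPDFReal μ v t := by
    funext y
    rw [hcdf, ← intervalIntegral.integral_Iic_sub_Iic
      (integrable_gaussianPDFReal μ v).integrableOn (integrable_gaussianPDFReal μ v).integrableOn]
    ring
  rw [hprim]
  exact ((continuous_gaussianPDFReal μ v).integral_hasStrictDerivAt 0 x).hasDerivAt.const_add _

lemma measureReal_Ici_eq_one_sub_cdf (μ : Measure ℝ) [IsProbabilityMeasure μ] [NullSingletonClass μ]
    (x : ℝ) :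
    μ.real (Set.Ici x) = 1 - cdf μ x := by
  rw [cdf_eq_real, ← measureReal_congr Iio_ae_eq_Iic, ← Set.compl_Iio,
    probReal_compl_eq_one_sub measurableSet_Iio]

lemma gaussianReal_real_neg_preimage (v : ℝ≥0) (s : Set ℝ) :
    (gaussianReal 0 v).real (Neg.neg ⁻¹' s) = (gaussianReal 0 v).real s := by
  have hneg : (gaussianReal 0 v).map Neg.neg = gaussianReal 0 v := by
    simpa using gaussianReal_map_neg (μ := 0) (v := v)
  conv_rhs => rw [← hneg]
  rw [measureReal_def, measureReal_def, measurableEmbedding_neg.map_apply]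

lemma cdf_gaussianReal_zero : cdf γ 0 = 1 / 2 := by
  have := nullSingletonClass_gaussianReal (μ := 0) one_ne_zero
  have hneg := gaussianReal_real_neg_preimage 1 (Set.Iic 0)
  rw [Set.neg_preimage, Set.neg_Iic, neg_zero, measureReal_Ici_eq_one_sub_cdf,
    ← cdf_eq_real] at hneg
  linarith

lemma integrable_pow_gaussianReal (μ : ℝ) (v : ℝ≥0) (k : ℕ) :
    Integrable (fun x => x ^ k) (gaussianReal μ v) := by
  have hnorm := (memLp_id_gaussianReal (μ := μ) (v := v) (k : ℝ≥0)).integrable_norm_pow'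
  exact hnorm.mono (by fun_prop) (ae_of_all _ fun x => by simp)

lemma integral_sq_gaussianReal : ∫ z, z ^ 2 ∂γ = 1 := by
  have h := variance_fun_id_gaussianReal (μ := 0) (v := 1)
  rw [variance_eq_integral (by fun_prop)] at h
  simpa using h

end Distribution

section QuadraticRoot

/-- The solution `z` of `z + β z² = v` that tends to `v` as `β → 0`. It is written with the square
root in the denominator so that `β = 0` is not exceptional. -/
noncomputable def quadRoot (β v : ℝ) : ℝ := 2 * v / (1 + √(1 + 4 * β * v))

variable {β v : ℝ}

lemma sqrt_discr_eq (h : 0 ≤ 1 + 4 * β * v) :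
    √(1 + 4 * β * v) = 1 + 2 * β * quadRoot β v := by
  have hsq : √(1 + 4 * β * v) ^ 2 = 1 + 4 * β * v := Real.sq_sqrt h
  have hpos : 1 + √(1 + 4 * β * v) ≠ 0 := by positivity
  unfold quadRoot
  field_simp
  linarith

lemma quadRoot_add_mul_sq (h : 0 ≤ 1 + 4 * β * v) :
    quadRoot β v + β * quadRoot β v ^ 2 = v := by
  have hmul : quadRoot β v * (1 + √(1 + 4 * β * v)) = 2 * v := by
    unfold quadRoot
    field_simp
  rw [sqrt_discr_eq h] at hmul
  linarith

lemma hasDerivAt_quadRoot (h : 0 < 1 + 4 * β * v) :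
    HasDerivAt (quadRoot β) (√(1 + 4 * β * v))⁻¹ v := by
  have hr : 0 < √(1 + 4 * β * v) := Real.sqrt_pos.2 h
  have hdiscr : HasDerivAt (fun v : ℝ => 1 + 4 * β * v) (4 * β) v := by
    simpa using ((hasDerivAt_id v).const_mul (4 * β)).const_add 1
  have hsq : √(1 + 4 * β * v) ^ 2 = 1 + 4 * β * v := Real.sq_sqrt h.le
  convert! ((hasDerivAt_id v).const_mul 2).div ((hdiscr.sqrt h.ne').const_add 1)
    (by positivity) using 1
  generalize √(1 + 4 * β * v) = r at *
  simp only [id_eq]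
  field_simp
  linear_combination -hsq

lemma le_add_mul_sq_iff_quadRoot_le (h : 0 ≤ 1 + 4 * β * v) {z : ℝ} (hz : |2 * β * z| < 1) :
    v ≤ z + β * z ^ 2 ↔ quadRoot β v ≤ z := by
  have hfactor : z + β * z ^ 2 - v
      = (z - quadRoot β v) * ((√(1 + 4 * β * v) + (1 + 2 * β * z)) / 2) := by
    linear_combination quadRoot_add_mul_sq h
      - (z - quadRoot β v) / 2 * sqrt_discr_eq h
  have hpos : 0 < (√(1 + 4 * β * v) + (1 + 2 * β * z)) / 2 := by
    linarith [Real.sqrt_nonneg (1 + 4 * β * v), (abs_lt.1 hz).1]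
  rw [← sub_nonneg, hfactor, mul_nonneg_iff_left_nonneg_of_pos hpos, sub_nonneg]

end QuadraticRoot

section DensityExpansion

lemma exp_sub_one_sub_le (x : ℝ) : Real.exp x - 1 - x ≤ x ^ 2 * (1 + Real.exp x) := by
  have hinv : (1 - x) * Real.exp x ≤ 1 := by
    have h := mul_le_mul_of_nonneg_right (Real.add_one_le_exp (-x)) (Real.exp_pos x).le
    rw [← Real.exp_add, neg_add_cancel, Real.exp_zero] at h
    linarith
  rcases le_total 0 x with hx | hx
  · nlinarith [mul_le_mul_of_nonneg_left hinv hx]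
  · nlinarith [mul_le_mul_of_nonpos_left (Real.add_one_le_exp x) hx, Real.exp_pos x]

lemma abs_stdGaussianPDF_sub_le (u z : ℝ) :
    |φ z - φ u * (1 + (u ^ 2 - z ^ 2) / 2)|
      ≤ ((u ^ 2 - z ^ 2) / 2) ^ 2 * (φ u + φ z) := by
  have hφ : 0 ≤ φ u := gaussianPDFReal_nonneg 0 1 u
  rw [stdGaussianPDF_eq_mul_exp u z]
  set x := (u ^ 2 - z ^ 2) / 2
  have hlower : 0 ≤ Real.exp x - 1 - x := by linarith [Real.add_one_le_exp x]
  calc |φ u * Real.exp x - φ u * (1 + x)| = φ u * (Real.exp x - 1 - x) := by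
        rw [← abs_of_nonneg (mul_nonneg hφ hlower)]; ring_nf
    _ ≤ φ u * (x ^ 2 * (1 + Real.exp x)) := by gcongr; exact exp_sub_one_sub_le x
    _ = x ^ 2 * (φ u + φ u * Real.exp x) := by ring

variable {β u z t M T : ℝ}

lemma abs_sq_sub_le (hM : 1 + |u| + |z| ≤ M) (hT : 1 + |t| ≤ T) : |z ^ 2 - t| ≤ M ^ 2 * T := by
  have := abs_nonneg u
  have := abs_nonneg z
  calc |z ^ 2 - t| ≤ |z| ^ 2 + |t| := by rw [← abs_pow]; exact abs_sub _ _
    _ ≤ M ^ 2 * T := by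
        have : |z| ^ 2 ≤ M ^ 2 := by gcongr; linarith
        nlinarith [abs_nonneg t, one_le_pow₀ (n := 2) (show 1 ≤ M by linarith)]

lemma abs_sub_le_of_add_mul_sq_sub_eq (h : z + β * (z ^ 2 - t) = u) (hM : 1 + |u| + |z| ≤ M)
    (hT : 1 + |t| ≤ T) : |u - z| ≤ |β| * (M ^ 2 * T) := by
  rw [← h, add_sub_cancel_left, abs_mul]
  gcongr
  exact abs_sq_sub_le hM hT

lemma abs_half_sq_sub_sq_le (h : z + β * (z ^ 2 - t) = u) (hM : 1 + |u| + |z| ≤ M)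
    (hT : 1 + |t| ≤ T) : |(u ^ 2 - z ^ 2) / 2| ≤ |β| * (M ^ 3 * T) := by
  have hadd : |(u + z) / 2| ≤ M := by
    rw [abs_div, abs_two]
    linarith [abs_add_le u z, abs_nonneg u, abs_nonneg z]
  calc |(u ^ 2 - z ^ 2) / 2| = |u - z| * |(u + z) / 2| := by rw [← abs_mul]; ring_nf
    _ ≤ |β| * (M ^ 2 * T) * M := by
        exact mul_le_mul (abs_sub_le_of_add_mul_sq_sub_eq h hM hT) hadd (abs_nonneg _)
          ((abs_nonneg _).trans (abs_sub_le_of_add_mul_sq_sub_eq h hM hT))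
    _ = |β| * (M ^ 3 * T) := by ring

lemma abs_half_sq_sub_sq_sub_le (h : z + β * (z ^ 2 - t) = u) (hM : 1 + |u| + |z| ≤ M)
    (hT : 1 + |t| ≤ T) :
    |(u ^ 2 - z ^ 2) / 2 - β * u * (u ^ 2 - t)| ≤ β ^ 2 * (M ^ 4 * T ^ 2) := by
  have hu := abs_nonneg u
  have hz := abs_nonneg z
  have hfactor : (u ^ 2 - z ^ 2) / 2 - β * u * (u ^ 2 - t)
      = β * (z - u) * (((z + u) ^ 2 + u ^ 2 - t) / 2) := by
    linear_combination (-(u + z) / 2) * h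
  have hquad : |((z + u) ^ 2 + u ^ 2 - t) / 2| ≤ M ^ 2 * T := by
    have hadd : (z + u) ^ 2 ≤ M ^ 2 := sq_le_sq' (by linarith [neg_abs_le z, neg_abs_le u])
      (by linarith [le_abs_self z, le_abs_self u])
    have hu2 : u ^ 2 ≤ M ^ 2 := sq_le_sq' (by linarith [neg_abs_le u]) (by linarith [le_abs_self u])
    have hM1 : 1 ≤ M ^ 2 := one_le_pow₀ (by linarith)
    rw [abs_div, abs_two, div_le_iff₀ two_pos]
    calc |(z + u) ^ 2 + u ^ 2 - t| ≤ (z + u) ^ 2 + u ^ 2 + |t| := by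
          refine (abs_sub _ _).trans_eq ?_
          rw [abs_of_nonneg (by positivity)]
      _ ≤ M ^ 2 * T * 2 := by nlinarith [abs_nonneg t]
  calc |(u ^ 2 - z ^ 2) / 2 - β * u * (u ^ 2 - t)|
      = |β| * |u - z| * |((z + u) ^ 2 + u ^ 2 - t) / 2| := by
        rw [hfactor, abs_mul, abs_mul, abs_sub_comm z u]
    _ ≤ |β| * (|β| * (M ^ 2 * T)) * (M ^ 2 * T) := by
        have := (abs_nonneg _).trans hquad
        gcongr
        exact abs_sub_le_of_add_mul_sq_sub_eq h hM hT
    _ = β ^ 2 * (M ^ 4 * T ^ 2) := by rw [← sq_abs β]; ring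

lemma abs_inv_one_add_le (hβz : |β * z| ≤ 1 / 8) : |(1 + 2 * β * z)⁻¹| ≤ 2 := by
  have hr : 1 / 2 ≤ 1 + 2 * β * z := by linarith [(abs_le.1 hβz).1]
  rw [abs_of_pos (by positivity)]
  exact inv_le_of_inv_le₀ two_pos (by linarith)

lemma abs_inv_sub_one_add_le (h : z + β * (z ^ 2 - t) = u) (hM : 1 + |u| + |z| ≤ M)
    (hT : 1 + |t| ≤ T) (hβz : |β * z| ≤ 1 / 8) :
    |(1 + 2 * β * z)⁻¹ - 1 + 2 * β * u| ≤ 10 * (β ^ 2 * (M ^ 2 * T)) := by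
  have hr : 1 / 2 ≤ 1 + 2 * β * z := by linarith [(abs_le.1 hβz).1]
  have hexpand : (1 + 2 * β * z)⁻¹ - 1 + 2 * β * u
      = 2 * (β * (u - z)) + 4 * (β ^ 2 * z ^ 2) * (1 + 2 * β * z)⁻¹ := by
    field_simp
    ring
  have hfirst : |2 * (β * (u - z))| ≤ 2 * (β ^ 2 * (M ^ 2 * T)) := by
    rw [abs_mul, abs_two, abs_mul, ← sq_abs β, pow_two |β|, mul_assoc]
    gcongr
    exact abs_sub_le_of_add_mul_sq_sub_eq h hM hT
  have hsecond : |4 * (β ^ 2 * z ^ 2) * (1 + 2 * β * z)⁻¹| ≤ 8 * (β ^ 2 * (M ^ 2 * T)) := by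
    have hinv : (1 + 2 * β * z)⁻¹ ≤ 2 := (le_abs_self _).trans (abs_inv_one_add_le hβz)
    have hz2 : z ^ 2 ≤ M ^ 2 * T := by
      have : z ^ 2 ≤ M ^ 2 := sq_le_sq' (by linarith [neg_abs_le z, abs_nonneg u])
        (by linarith [le_abs_self z, abs_nonneg u])
      nlinarith [abs_nonneg t]
    have hT0 : 0 ≤ T := by linarith [abs_nonneg t]
    rw [abs_of_nonneg (by positivity)]
    calc 4 * (β ^ 2 * z ^ 2) * (1 + 2 * β * z)⁻¹ ≤ 4 * (β ^ 2 * (M ^ 2 * T)) * 2 := by gcongr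
      _ = 8 * (β ^ 2 * (M ^ 2 * T)) := by ring
  rw [hexpand]
  linarith [abs_add_le (2 * (β * (u - z))) (4 * (β ^ 2 * z ^ 2) * (1 + 2 * β * z)⁻¹)]

lemma abs_le_of_add_mul_sq_sub_eq (h : z + β * (z ^ 2 - t) = u) (hβz : |β * z| ≤ 1 / 8)
    (hβt : |β| * (1 + |t|) ≤ 1 / 8) : |u| ≤ 2 * |z| + 1 ∧ |z| ≤ 2 * |u| + 1 := by
  have hdiff : |u - z| ≤ 1 / 8 * |z| + 1 / 8 := by
    calc |u - z| = |β * z * z - β * t| := by rw [← h]; ring_nf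
      _ ≤ |β * z| * |z| + |β| * |t| := by
        rw [← abs_mul, ← abs_mul]
        exact abs_sub _ _
      _ ≤ 1 / 8 * |z| + 1 / 8 := by
        gcongr
        linarith [abs_nonneg β]
  have h1 := abs_sub_abs_le_abs_sub u z
  have h2 := abs_sub_abs_le_abs_sub z u
  rw [abs_sub_comm] at h2
  constructor <;> linarith [abs_nonneg z]

lemma abs_one_add_mul_inv_sub_le (h : z + β * (z ^ 2 - t) = u) (hM : 1 + |u| + |z| ≤ M)
    (hT : 1 + |t| ≤ T) (hβz : |β * z| ≤ 1 / 8) (hβu : |β * u| ≤ 1 / 8) :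
    |(1 + (u ^ 2 - z ^ 2) / 2) * (1 + 2 * β * z)⁻¹ - (1 + β * u * (u ^ 2 - t - 2))|
      ≤ 24 * (β ^ 2 * (M ^ 4 * T ^ 2)) := by
  have hu := abs_nonneg u
  have hz := abs_nonneg z
  have hM1 : 1 ≤ M ^ 2 := one_le_pow₀ (by linarith)
  have hT1 : 1 ≤ T := by linarith [abs_nonneg t]
  have hinv : |(1 + 2 * β * z)⁻¹| ≤ 2 := abs_inv_one_add_le hβz
  have hsq : |u ^ 2 - t| ≤ M ^ 2 * T := abs_sq_sub_le (u := z) (by linarith) hT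
  have hw : |1 + β * u * (u ^ 2 - t)| ≤ 2 * (M ^ 2 * T) := by
    refine (abs_add_le _ _).trans ?_
    rw [abs_one, abs_mul]
    nlinarith [mul_le_mul hβu hsq (abs_nonneg _) (by norm_num)]
  have hcross : |2 * β * u * (β * u * (u ^ 2 - t))| ≤ 2 * (β ^ 2 * (M ^ 4 * T ^ 2)) := by
    have hu2 : u ^ 2 ≤ M ^ 2 := sq_le_sq' (by linarith [neg_abs_le u]) (by linarith [le_abs_self u])
    calc |2 * β * u * (β * u * (u ^ 2 - t))| = 2 * (β ^ 2 * (u ^ 2 * |u ^ 2 - t|)) := by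
          rw [show 2 * β * u * (β * u * (u ^ 2 - t)) = 2 * (β ^ 2 * u ^ 2) * (u ^ 2 - t) by ring,
            abs_mul, abs_of_nonneg (by positivity)]
          ring
      _ ≤ 2 * (β ^ 2 * (M ^ 2 * (M ^ 2 * T))) := by gcongr
      _ ≤ 2 * (β ^ 2 * (M ^ 2 * (M ^ 2 * T ^ 2))) := by gcongr; exact le_self_pow₀ hT1 two_ne_zero
      _ = 2 * (β ^ 2 * (M ^ 4 * T ^ 2)) := by ring
  have hsplit : (1 + (u ^ 2 - z ^ 2) / 2) * (1 + 2 * β * z)⁻¹ - (1 + β * u * (u ^ 2 - t - 2))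
      = ((u ^ 2 - z ^ 2) / 2 - β * u * (u ^ 2 - t)) * (1 + 2 * β * z)⁻¹
        + (1 + β * u * (u ^ 2 - t)) * ((1 + 2 * β * z)⁻¹ - 1 + 2 * β * u)
        - 2 * β * u * (β * u * (u ^ 2 - t)) := by ring
  rw [hsplit]
  refine (abs_sub _ _).trans ((add_le_add_left (abs_add_le _ _) _).trans ?_)
  rw [abs_mul, abs_mul]
  have h1 := mul_le_mul (abs_half_sq_sub_sq_sub_le h hM hT) hinv (abs_nonneg _) (by positivity)
  have h2 := mul_le_mul hw (abs_inv_sub_one_add_le h hM hT hβz) (abs_nonneg _) (by positivity)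
  linarith

lemma stdGaussianPDF_mul_pow_le {y : ℝ} (hM0 : 0 ≤ M) (hM : M ≤ 3 * (1 + |y|)) (k : ℕ) :
    φ y * M ^ k ≤ 3 ^ k * (k.factorial * Real.exp 2) := by
  have hφ : 0 ≤ φ y := gaussianPDFReal_nonneg 0 1 y
  calc φ y * M ^ k ≤ φ y * (3 * (1 + |y|)) ^ k := by gcongr
    _ = 3 ^ k * (φ y * (1 + |y|) ^ k) := by rw [mul_pow]; ring
    _ ≤ 3 ^ k * (k.factorial * Real.exp 2) :=
      mul_le_mul_of_nonneg_left (stdGaussianPDF_mul_one_add_abs_pow_le y k) (by positivity)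

lemma abs_stdGaussianPDF_sub_le_of_add_mul_sq_sub_eq (h : z + β * (z ^ 2 - t) = u)
    (hM : 1 + |u| + |z| ≤ M) (hT : 1 + |t| ≤ T) {K : ℝ} (hφu : φ u * M ^ 6 ≤ K)
    (hφz : φ z * M ^ 6 ≤ K) :
    |φ z - φ u * (1 + (u ^ 2 - z ^ 2) / 2)| ≤ 2 * K * (β ^ 2 * T ^ 2) := by
  have hφu0 : 0 ≤ φ u := gaussianPDFReal_nonneg 0 1 u
  have hφz0 : 0 ≤ φ z := gaussianPDFReal_nonneg 0 1 z
  have hx : ((u ^ 2 - z ^ 2) / 2) ^ 2 ≤ β ^ 2 * (M ^ 6 * T ^ 2) := by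
    have := pow_le_pow_left₀ (abs_nonneg _) (abs_half_sq_sub_sq_le h hM hT) 2
    rw [sq_abs, mul_pow, sq_abs] at this
    exact this.trans_eq (by ring)
  calc |φ z - φ u * (1 + (u ^ 2 - z ^ 2) / 2)|
      ≤ β ^ 2 * (M ^ 6 * T ^ 2) * (φ u + φ z) :=
        (abs_stdGaussianPDF_sub_le u z).trans (by gcongr)
    _ = (φ u * M ^ 6 + φ z * M ^ 6) * (β ^ 2 * T ^ 2) := by ring
    _ ≤ 2 * K * (β ^ 2 * T ^ 2) := by gcongr; linarith

lemma abs_stdGaussianPDF_mul_inv_sub_le (h : z + β * (z ^ 2 - t) = u) (hβz : |β * z| ≤ 1 / 8)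
    (hβu : |β * u| ≤ 1 / 8) (hβt : |β| * (1 + |t|) ≤ 1 / 8) :
    |φ z * (1 + 2 * β * z)⁻¹ - φ u * (1 + β * u * (u ^ 2 - t - 2))|
      ≤ 28 * (3 ^ 6 * (Nat.factorial 6 * Real.exp 2)) * (β ^ 2 * (1 + |t|) ^ 2) := by
  set K : ℝ := 3 ^ 6 * (Nat.factorial 6 * Real.exp 2)
  set x := (u ^ 2 - z ^ 2) / 2
  set M := 1 + |u| + |z|
  set T := 1 + |t|
  have hM : 1 ≤ M := by linarith [abs_nonneg u, abs_nonneg z]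
  obtain ⟨huz, hzu⟩ := abs_le_of_add_mul_sq_sub_eq h hβz hβt
  have hφu : φ u * M ^ 6 ≤ K := stdGaussianPDF_mul_pow_le (by positivity) (by linarith) 6
  have hφz : φ z * M ^ 6 ≤ K := stdGaussianPDF_mul_pow_le (by positivity) (by linarith) 6
  have hφu0 : 0 ≤ φ u := gaussianPDFReal_nonneg 0 1 u
  have hinv : |(1 + 2 * β * z)⁻¹| ≤ 2 := abs_inv_one_add_le hβz
  have hexp : |φ z - φ u * (1 + x)| ≤ 2 * K * (β ^ 2 * T ^ 2) :=
    abs_stdGaussianPDF_sub_le_of_add_mul_sq_sub_eq h le_rfl le_rfl hφu hφz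
  have hpoly : |(1 + x) * (1 + 2 * β * z)⁻¹ - (1 + β * u * (u ^ 2 - t - 2))|
      ≤ 24 * (β ^ 2 * (M ^ 6 * T ^ 2)) := by
    refine (abs_one_add_mul_inv_sub_le h le_rfl le_rfl hβz hβu).trans ?_
    gcongr
    norm_num
  calc _ = |(φ z - φ u * (1 + x)) * (1 + 2 * β * z)⁻¹
        + φ u * ((1 + x) * (1 + 2 * β * z)⁻¹ - (1 + β * u * (u ^ 2 - t - 2)))| := by ring_nf
    _ ≤ |φ z - φ u * (1 + x)| * |(1 + 2 * β * z)⁻¹|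
        + φ u * |(1 + x) * (1 + 2 * β * z)⁻¹ - (1 + β * u * (u ^ 2 - t - 2))| := by
        refine (abs_add_le _ _).trans_eq ?_
        rw [abs_mul, abs_mul, abs_of_nonneg hφu0]
    _ ≤ 2 * K * (β ^ 2 * T ^ 2) * 2 + φ u * (24 * (β ^ 2 * (M ^ 6 * T ^ 2))) := by gcongr
    _ = 4 * K * (β ^ 2 * T ^ 2) + 24 * (φ u * M ^ 6) * (β ^ 2 * T ^ 2) := by ring
    _ ≤ 28 * K * (β ^ 2 * T ^ 2) := by nlinarith [sq_nonneg (β * T)]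

lemma abs_four_mul_mul_add_le (hβu : |β * u| ≤ 1 / 16) (hβt : |β| * (1 + |t|) ≤ 1 / 16) :
    |4 * β * (u + β * t)| ≤ 7 / 16 := by
  have hβ : |β| ≤ 1 / 16 := by nlinarith [abs_nonneg β, abs_nonneg t]
  have hββ : |β| * (|β| * |t|) ≤ 1 / 16 * (1 / 16) := by
    gcongr
    linarith [abs_nonneg β]
  calc |4 * β * (u + β * t)| = 4 * |β * u + β * (β * t)| := by
        rw [show 4 * β * (u + β * t) = 4 * (β * u + β * (β * t)) by ring, abs_mul,
          abs_of_pos four_pos]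
    _ ≤ 4 * (1 / 16 + 1 / 16 * (1 / 16)) := by
        gcongr
        refine (abs_add_le _ _).trans (add_le_add hβu ?_)
        rwa [abs_mul, abs_mul]
    _ ≤ 7 / 16 := by norm_num

/-- The density at `u` of `z ↦ z + β (z² - t)` under the standard Gaussian law, read off on the
branch where this map is increasing, as a function of `v = u + β t`. -/
noncomputable def quadDensity (β v : ℝ) : ℝ := φ (quadRoot β v) * (√(1 + 4 * β * v))⁻¹

lemma exists_abs_quadDensity_sub_le :
    ∃ C, 0 ≤ C ∧ ∀ {β u t : ℝ}, |β * u| ≤ 1 / 16 → |β| * (1 + |t|) ≤ 1 / 16 →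
      |quadDensity β (u + β * t) - φ u * (1 + β * u * (u ^ 2 - t - 2))|
        ≤ C * (β ^ 2 * (1 + |t|) ^ 2) := by
  refine ⟨28 * (3 ^ 6 * (Nat.factorial 6 * Real.exp 2)), by positivity,
    fun {β u t} hβu hβt => ?_⟩
  have hdiscr := abs_four_mul_mul_add_le hβu hβt
  obtain ⟨hd1, hd2⟩ := abs_le.1 hdiscr
  have hroot := quadRoot_add_mul_sq (β := β) (v := u + β * t) (by linarith)
  have hsqrt := sqrt_discr_eq (β := β) (v := u + β * t) (by linarith)
  have hβz : |β * quadRoot β (u + β * t)| ≤ 1 / 8 := by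
    have h1 : 3 / 4 ≤ √(1 + 4 * β * (u + β * t)) := Real.le_sqrt_of_sq_le (by linarith)
    have h2 : √(1 + 4 * β * (u + β * t)) ≤ 5 / 4 :=
      Real.sqrt_le_iff.2 ⟨by norm_num, by linarith⟩
    rw [hsqrt] at h1 h2
    exact abs_le.2 ⟨by linarith, by linarith⟩
  rw [quadDensity, hsqrt]
  exact abs_stdGaussianPDF_mul_inv_sub_le (by linear_combination hroot) hβz (by linarith)
    (by linarith)

end DensityExpansion

section QuadraticTail

lemma measureReal_one_le_abs_le_integral_pow_four {Ω : Type*} [MeasurableSpace Ω] {μ : Measure Ω}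
    {X : Ω → ℝ} (hX : Integrable (fun ω => X ω ^ 4) μ) :
    μ.real {ω | 1 ≤ |X ω|} ≤ ∫ ω, X ω ^ 4 ∂μ := by
  have hset : {ω | 1 ≤ |X ω|} = {ω | 1 ≤ X ω ^ 4} := by
    ext ω
    simp only [Set.mem_ofPred_eq, ← (show Even 4 by decide).pow_abs (X ω)]
    exact (one_le_pow_iff_of_nonneg (abs_nonneg _) four_ne_zero).symm
  rw [hset]
  simpa using mul_meas_ge_le_integral_of_nonneg (ae_of_all μ fun ω => by positivity) hX 1

lemma abs_gaussianReal_real_sub_one_sub_cdf_quadRoot_le {β v : ℝ} (h : 0 ≤ 1 + 4 * β * v) :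
    |(γ).real {z | v ≤ z + β * z ^ 2} - (1 - cdf γ (quadRoot β v))|
      ≤ 16 * (∫ z, z ^ 4 ∂γ) * β ^ 4 := by
  have := nullSingletonClass_gaussianReal (μ := 0) one_ne_zero
  rw [← measureReal_Ici_eq_one_sub_cdf]
  refine (abs_measureReal_sub_le_measureReal_symmDiff
    (measurableSet_le (by fun_prop) (by fun_prop)).nullMeasurableSet
    measurableSet_Ici.nullMeasurableSet).trans ?_
  have hsubset : symmDiff {z | v ≤ z + β * z ^ 2} (Set.Ici (quadRoot β v))
      ⊆ {z | 1 ≤ |2 * β * z|} := by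
    intro z hz
    by_contra! hlt
    rw [Set.mem_symmDiff] at hz
    have := le_add_mul_sq_iff_quadRoot_le h (not_le.1 hlt)
    simp only [Set.mem_ofPred_eq, Set.mem_Ici] at hz
    tauto
  have hmarkov := measureReal_one_le_abs_le_integral_pow_four (μ := γ) (X := fun z => 2 * β * z)
    (by simpa only [mul_pow] using (integrable_pow_gaussianReal 0 1 4).const_mul _)
  calc _ ≤ (γ).real {z | 1 ≤ |2 * β * z|} := measureReal_mono hsubset
    _ ≤ ∫ z, (2 * β * z) ^ 4 ∂γ := hmarkov
    _ = 16 * (∫ z, z ^ 4 ∂γ) * β ^ 4 := by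
      simp only [mul_pow, integral_const_mul]
      ring

/-- The probability that the perturbation `Z + b (Z² - s)` of a standard normal `Z` is at least
`u` in absolute value. -/
noncomputable def quadTail (b u s : ℝ) : ℝ := (γ).real {z | u ≤ |z + b * (z ^ 2 - s)|}

lemma quadTail_eq_add {u : ℝ} (hu : 0 < u) (b s : ℝ) :
    quadTail b u s = (γ).real {z | u + b * s ≤ z + b * z ^ 2}
      + (γ).real {z | u + -b * s ≤ z + -b * z ^ 2} := by
  have hneg : (γ).real {z | u + -b * s ≤ z + -b * z ^ 2}
      = (γ).real {z | z + b * (z ^ 2 - s) ≤ -u} := by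
    rw [← gaussianReal_real_neg_preimage]
    congr 1 with z
    simp only [Set.mem_preimage, Set.mem_ofPred_eq]
    constructor <;> intro h <;> linarith [neg_sq z]
  have hdisj : Disjoint {z : ℝ | u + b * s ≤ z + b * z ^ 2} {z | z + b * (z ^ 2 - s) ≤ -u} := by
    rw [Set.disjoint_left]
    intro z h1 h2
    simp only [Set.mem_ofPred_eq] at h1 h2
    linarith
  rw [hneg, ← measureReal_union hdisj (by measurability), quadTail]
  congr 1 with z
  simp only [Set.mem_ofPred_eq, Set.mem_union, le_abs']
  rw [or_comm, show u ≤ z + b * (z ^ 2 - s) ↔ u + b * s ≤ z + b * z ^ 2 by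
    constructor <;> intro h <;> linarith]

/-- The contributions of the two increasing branches to `quadTail b u s`. -/
noncomputable def branchTail (b u s : ℝ) : ℝ :=
  (1 - cdf γ (quadRoot b (u + b * s))) + (1 - cdf γ (quadRoot (-b) (u + -b * s)))

lemma abs_quadTail_sub_branchTail_le {b u s : ℝ} (hu : 0 < u)
    (h1 : 0 ≤ 1 + 4 * b * (u + b * s)) (h2 : 0 ≤ 1 + 4 * -b * (u + -b * s)) :
    |quadTail b u s - branchTail b u s| ≤ 32 * (∫ z, z ^ 4 ∂γ) * b ^ 4 := by
  have hplus := abs_gaussianReal_real_sub_one_sub_cdf_quadRoot_le h1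
  have hminus := abs_gaussianReal_real_sub_one_sub_cdf_quadRoot_le h2
  rw [Even.neg_pow (by decide)] at hminus
  rw [quadTail_eq_add hu, branchTail, add_sub_add_comm]
  exact (abs_add_le _ _).trans (by linarith)

lemma hasDerivAt_cdf_quadRoot {β v : ℝ} (h : 0 < 1 + 4 * β * v) :
    HasDerivAt (fun v => cdf γ (quadRoot β v)) (quadDensity β v) v :=
  (hasDerivAt_cdf_gaussianReal 0 one_ne_zero _).comp v (hasDerivAt_quadRoot h)

lemma hasDerivAt_branchTail {b u t : ℝ} (h1 : 0 < 1 + 4 * b * (u + b * t))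
    (h2 : 0 < 1 + 4 * -b * (u + -b * t)) :
    HasDerivAt (branchTail b u)
      (b * (quadDensity (-b) (u + -b * t) - quadDensity b (u + b * t))) t := by
  have haffine : ∀ β : ℝ, HasDerivAt (fun t => u + β * t) β t := fun β => by
    simpa using ((hasDerivAt_id t).const_mul β).const_add u
  have hplus := ((hasDerivAt_cdf_quadRoot h1).comp t (haffine b)).const_sub 1
  have hminus := ((hasDerivAt_cdf_quadRoot h2).comp t (haffine (-b))).const_sub 1
  exact (hplus.add hminus).congr_deriv (by ring)

lemma exists_abs_deriv_branchTail_sub_le :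
    ∃ C, 0 ≤ C ∧ ∀ {b u t : ℝ}, 0 < b → |b * u| ≤ 1 / 16 → |b| * (1 + |t|) ≤ 1 / 16 →
      |b * (quadDensity (-b) (u + -b * t) - quadDensity b (u + b * t))
          - b ^ 2 * (φ u * u * (2 * t + 4 - 2 * u ^ 2))| ≤ C * (b ^ 3 * (1 + |t|) ^ 2) := by
  obtain ⟨C, hC, hexpand⟩ := exists_abs_quadDensity_sub_le
  refine ⟨2 * C, by positivity, fun {b u t} hb hbu hbt => ?_⟩
  have hplus := hexpand hbu hbt
  have hminus := hexpand (β := -b) (u := u) (t := t) (by simpa using hbu) (by simpa using hbt)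
  rw [neg_sq] at hminus
  calc _ = b * |(quadDensity (-b) (u + -b * t) - φ u * (1 + -b * u * (u ^ 2 - t - 2)))
        - (quadDensity b (u + b * t) - φ u * (1 + b * u * (u ^ 2 - t - 2)))| := by
        rw [← abs_of_pos hb, ← abs_mul, abs_of_pos hb]
        congr 1
        ring
    _ ≤ b * (C * (b ^ 2 * (1 + |t|) ^ 2) + C * (b ^ 2 * (1 + |t|) ^ 2)) := by
        gcongr
        exact (abs_sub _ _).trans (add_le_add hminus hplus)
    _ = 2 * C * (b ^ 3 * (1 + |t|) ^ 2) := by ring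

/-- The second-order coefficient in `b` of `quadTail b u s - quadTail b u 0`. -/
noncomputable def tailCoeff (u s : ℝ) : ℝ := φ u * u * (s ^ 2 + 4 * s - 2 * u ^ 2 * s)

lemma exists_abs_branchTail_sub_le :
    ∃ C, 0 ≤ C ∧ ∀ {b u s : ℝ}, 0 < b → |b * u| ≤ 1 / 16 → |b| * (1 + |s|) ≤ 1 / 16 →
      |branchTail b u s - branchTail b u 0 - b ^ 2 * tailCoeff u s|
        ≤ C * (b ^ 3 * (1 + |s|) ^ 3) := by
  obtain ⟨C, hC, hderiv_le⟩ := exists_abs_deriv_branchTail_sub_le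
  refine ⟨C, hC, fun {b u s} hb hbu hbs => ?_⟩
  set H : ℝ → ℝ := fun t =>
    branchTail b u t - b ^ 2 * tailCoeff u t with hH
  set H' : ℝ → ℝ := fun t =>
    b * (quadDensity (-b) (u + -b * t) - quadDensity b (u + b * t))
      - b ^ 2 * (φ u * u * (2 * t + 4 - 2 * u ^ 2))
  have hbt : ∀ t ∈ Set.Icc (-|s|) |s|, |b| * (1 + |t|) ≤ 1 / 16 := fun t ht =>
    hbs.trans' (by have := abs_le.2 ht; gcongr)
  have hderiv : ∀ t ∈ Set.Icc (-|s|) |s|, HasDerivWithinAt H (H' t) (Set.Icc (-|s|) |s|) t := by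
    intro t ht
    have hd1 := abs_le.1 (abs_four_mul_mul_add_le hbu (hbt t ht))
    have hd2 := abs_le.1 (abs_four_mul_mul_add_le (β := -b) (u := u) (t := t) (by simpa using hbu)
      (by simpa using hbt t ht))
    have hpoly : HasDerivAt (fun t : ℝ => t ^ 2 + 4 * t - 2 * u ^ 2 * t)
        (2 * t + 4 - 2 * u ^ 2) t := by
      convert! ((hasDerivAt_pow 2 t).add ((hasDerivAt_id t).const_mul 4)).sub
        ((hasDerivAt_id t).const_mul (2 * u ^ 2)) using 1
      norm_num
    exact ((hasDerivAt_branchTail (by linarith) (by linarith)).sub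
      ((hpoly.const_mul (φ u * u)).const_mul (b ^ 2))).hasDerivWithinAt
  have hbound : ∀ t ∈ Set.Icc (-|s|) |s|, ‖H' t‖ ≤ C * (b ^ 3 * (1 + |s|) ^ 2) := fun t ht =>
    (hderiv_le hb hbu (hbt t ht)).trans (by have := abs_le.2 ht; gcongr)
  have hmvt := (convex_Icc (-|s|) |s|).norm_image_sub_le_of_norm_hasDerivWithin_le hderiv hbound
    (show (0 : ℝ) ∈ _ by simp) (abs_le.1 (le_refl |s|))
  calc _ = ‖H s - H 0‖ := by
        simp only [hH, tailCoeff, Real.norm_eq_abs]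
        ring_nf
    _ ≤ C * (b ^ 3 * (1 + |s|) ^ 2) * |s| := by simpa only [sub_zero, Real.norm_eq_abs] using hmvt
    _ ≤ C * (b ^ 3 * (1 + |s|) ^ 2) * (1 + |s|) := by gcongr; linarith
    _ = C * (b ^ 3 * (1 + |s|) ^ 3) := by ring

lemma abs_tailCoeff_le {u : ℝ} (hu : 0 < u) (s : ℝ) :
    |tailCoeff u s| ≤ 4 * (φ u * (1 + |u|) ^ 3) * (1 + |s|) ^ 2 := by
  have hφ : 0 ≤ φ u := gaussianPDFReal_nonneg 0 1 u
  have hs := abs_nonneg s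
  have hpoly : |s ^ 2 + 4 * s - 2 * u ^ 2 * s| ≤ 4 * ((1 + u) ^ 2 * (1 + |s|) ^ 2) := by
    calc |s ^ 2 + 4 * s - 2 * u ^ 2 * s| ≤ |s| ^ 2 + 4 * |s| + 2 * u ^ 2 * |s| := by
          refine (abs_sub _ _).trans (add_le_add ((abs_add_le _ _).trans ?_) ?_) <;>
            simp [abs_mul]
      _ ≤ 4 * ((1 + u) ^ 2 * (1 + |s|) ^ 2) := by
          nlinarith [mul_nonneg hu.le hs, mul_nonneg (mul_nonneg hu.le hs) hs,
            mul_nonneg (sq_nonneg u) (sq_nonneg |s|), mul_nonneg (sq_nonneg u) hs]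
  have hu' : u ≤ 1 + u := by linarith
  calc |tailCoeff u s| = φ u * u * |s ^ 2 + 4 * s - 2 * u ^ 2 * s| := by
        rw [tailCoeff, abs_mul, abs_of_nonneg (by positivity)]
    _ ≤ φ u * (1 + u) * (4 * ((1 + u) ^ 2 * (1 + |s|) ^ 2)) := by gcongr
    _ = 4 * (φ u * (1 + |u|) ^ 3) * (1 + |s|) ^ 2 := by rw [abs_of_pos hu]; ring

lemma quadTail_le_of_lt {b u s : ℝ} (hb : 0 < b) (hbu : 1 / 16 < b * u)
    (hbs : b * (1 + |s|) ≤ 1 / 16) : quadTail b u s ≤ (64 * b) ^ 4 * ∫ z, z ^ 4 ∂γ := by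
  have hsubset : {z | u ≤ |z + b * (z ^ 2 - s)|} ⊆ {z | 1 ≤ |64 * b * z|} := by
    intro z hz
    rw [Set.mem_ofPred_eq] at hz ⊢
    by_contra! hlt
    have hbz : b * |z| < 1 / 64 := by
      rw [abs_mul, abs_of_pos (by positivity)] at hlt
      linarith
    have hbz0 : 0 ≤ b * |z| := by positivity
    have hbs0 : 0 ≤ b * |s| := by positivity
    have hbound : b * u ≤ b * |z| + (b * |z|) ^ 2 + b * (b * |s|) := by
      calc b * u ≤ b * (|z| + |b * z ^ 2| + |b * s|) := by
            gcongr
            refine hz.trans ?_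
            rw [mul_sub, ← add_sub_assoc]
            exact (abs_sub _ _).trans (by gcongr; exact abs_add_le _ _)
        _ = b * |z| + (b * |z|) ^ 2 + b * (b * |s|) := by
            rw [abs_mul, abs_mul, abs_pow, abs_of_pos hb]
            ring
    nlinarith
  have hmarkov := measureReal_one_le_abs_le_integral_pow_four (μ := γ) (X := fun z => 64 * b * z)
    (by simpa only [mul_pow] using (integrable_pow_gaussianReal 0 1 4).const_mul _)
  calc quadTail b u s ≤ (γ).real {z | 1 ≤ |64 * b * z|} := measureReal_mono hsubset
    _ ≤ ∫ z, (64 * b * z) ^ 4 ∂γ := hmarkov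
    _ = (64 * b) ^ 4 * ∫ z, z ^ 4 ∂γ := by simp only [mul_pow, integral_const_mul]

section Expansion

variable {b u s : ℝ}

lemma abs_quadTail_expansion_le_of_lt_one_add_abs (hb : 0 < b) (hu : 0 < u)
    (hbs : 1 / 16 < b * (1 + |s|)) :
    |quadTail b u s - quadTail b u 0 - b ^ 2 * tailCoeff u s|
      ≤ (16 ^ 3 + 64 * (Nat.factorial 3 * Real.exp 2)) * (b ^ 3 * (1 + |s|) ^ 3) := by
  set K : ℝ := Nat.factorial 3 * Real.exp 2
  have hprob : |quadTail b u s - quadTail b u 0| ≤ 1 :=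
    abs_sub_le_of_nonneg_of_le measureReal_nonneg measureReal_le_one measureReal_nonneg
      measureReal_le_one
  have hcoeff : |tailCoeff u s| ≤ 4 * K * (1 + |s|) ^ 2 := by
    refine (abs_tailCoeff_le hu s).trans ?_
    have := stdGaussianPDF_mul_one_add_abs_pow_le u 3
    gcongr
  have hone : 1 ≤ 16 * (b * (1 + |s|)) := by linarith
  calc _ ≤ 1 + b ^ 2 * (4 * K * (1 + |s|) ^ 2) := by
        refine (abs_sub _ _).trans ?_
        rw [abs_mul, abs_of_nonneg (sq_nonneg b)]
        gcongr
    _ = 1 ^ 3 + 4 * K * (b * (1 + |s|)) ^ 2 * 1 := by ring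
    _ ≤ (16 * (b * (1 + |s|))) ^ 3 + 4 * K * (b * (1 + |s|)) ^ 2 * (16 * (b * (1 + |s|))) := by
        gcongr
    _ = (16 ^ 3 + 64 * K) * (b ^ 3 * (1 + |s|) ^ 3) := by ring

lemma abs_quadTail_expansion_le_of_lt_mul (hb : 0 < b) (hu : 0 < u) (hbu : 1 / 16 < b * u)
    (hbs : b * (1 + |s|) ≤ 1 / 16) :
    |quadTail b u s - quadTail b u 0 - b ^ 2 * tailCoeff u s|
      ≤ (64 ^ 4 * (∫ z, z ^ 4 ∂γ) + 64 * (Nat.factorial 4 * Real.exp 2))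
        * (b ^ 3 * (1 + |s|) ^ 3) := by
  set K : ℝ := Nat.factorial 4 * Real.exp 2
  set m : ℝ := ∫ z, z ^ 4 ∂γ
  have : 0 ≤ m := integral_nonneg fun z => by positivity
  have hs := abs_nonneg s
  have hb1 : b ≤ 1 := by nlinarith
  have hbs0 : b * (1 + |(0 : ℝ)|) ≤ 1 / 16 := by
    rw [abs_zero]
    nlinarith
  have hprob : |quadTail b u s - quadTail b u 0| ≤ (64 * b) ^ 4 * m :=
    abs_sub_le_of_nonneg_of_le measureReal_nonneg (quadTail_le_of_lt hb hbu hbs)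
      measureReal_nonneg (quadTail_le_of_lt hb hbu hbs0)
  have hdens : φ u * (1 + |u|) ^ 3 ≤ 16 * b * K := by
    have hφ : 0 ≤ φ u := gaussianPDFReal_nonneg 0 1 u
    have hone : 1 ≤ 16 * b * (1 + |u|) := by
      rw [abs_of_pos hu]
      linarith
    calc φ u * (1 + |u|) ^ 3 ≤ φ u * (1 + |u|) ^ 3 * (16 * b * (1 + |u|)) :=
          le_mul_of_one_le_right (by positivity) hone
      _ = 16 * b * (φ u * (1 + |u|) ^ 4) := by ring
      _ ≤ 16 * b * K := mul_le_mul_of_nonneg_left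
          (stdGaussianPDF_mul_one_add_abs_pow_le u 4) (by positivity)
  have hcoeff : |tailCoeff u s| ≤ 4 * (16 * b * K) * (1 + |s|) ^ 2 :=
    (abs_tailCoeff_le hu s).trans (by gcongr)
  calc _ ≤ (64 * b) ^ 4 * m + b ^ 2 * (4 * (16 * b * K) * (1 + |s|) ^ 2) := by
        refine (abs_sub _ _).trans ?_
        rw [abs_mul, abs_of_nonneg (sq_nonneg b)]
        gcongr
    _ = (64 ^ 4 * m * b * 1 + 64 * K * (1 + |s|) ^ 2) * b ^ 3 := by ring
    _ ≤ (64 ^ 4 * m * 1 * (1 + |s|) ^ 3 + 64 * K * (1 + |s|) ^ 3) * b ^ 3 := by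
        gcongr
        · exact one_le_pow₀ (by linarith)
        · linarith
        · norm_num
    _ = (64 ^ 4 * m + 64 * K) * (b ^ 3 * (1 + |s|) ^ 3) := by ring

lemma exists_abs_quadTail_expansion_le_of_le :
    ∃ C, 0 ≤ C ∧ ∀ {b u s : ℝ}, 0 < b → 0 < u → b * u ≤ 1 / 16 → b * (1 + |s|) ≤ 1 / 16 →
      |quadTail b u s - quadTail b u 0 - b ^ 2 * tailCoeff u s|
        ≤ C * (b ^ 3 * (1 + |s|) ^ 3) := by
  obtain ⟨C, hC, hbranch⟩ := exists_abs_branchTail_sub_le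
  set m : ℝ := ∫ z, z ^ 4 ∂γ
  have hm : 0 ≤ m := integral_nonneg fun z => by positivity
  refine ⟨64 * m + C, by positivity, fun {b u s} hb hu hbu hbs => ?_⟩
  have hs := abs_nonneg s
  have hbu' : |b * u| ≤ 1 / 16 := by rwa [abs_of_pos (by positivity)]
  have hsplit : ∀ t, |t| ≤ |s| → |quadTail b u t - branchTail b u t| ≤ 32 * m * b ^ 4 := by
    intro t ht
    have hbt : |b| * (1 + |t|) ≤ 1 / 16 := by
      rw [abs_of_pos hb]
      exact hbs.trans' (by gcongr)
    have hd1 := abs_le.1 (abs_four_mul_mul_add_le hbu' hbt)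
    have hd2 := abs_le.1 (abs_four_mul_mul_add_le (β := -b) (u := u) (t := t)
      (by simpa using hbu') (by simpa using hbt))
    exact abs_quadTail_sub_branchTail_le hu (by linarith) (by linarith)
  have hmain := hbranch (s := s) hb hbu' (by rwa [abs_of_pos hb])
  have hb4 : b ^ 4 ≤ b ^ 3 * (1 + |s|) ^ 3 := by
    calc b ^ 4 = b ^ 3 * b := by ring
      _ ≤ b ^ 3 * (1 + |s|) ^ 3 := by
        gcongr
        exact (by nlinarith : b ≤ 1).trans (one_le_pow₀ (by linarith))
  calc _ = |(quadTail b u s - branchTail b u s) - (quadTail b u 0 - branchTail b u 0)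
        + (branchTail b u s - branchTail b u 0 - b ^ 2 * tailCoeff u s)| := by
        congr 1
        ring
    _ ≤ 32 * m * b ^ 4 + 32 * m * b ^ 4 + C * (b ^ 3 * (1 + |s|) ^ 3) :=
        (abs_add_le _ _).trans (add_le_add ((abs_sub _ _).trans
          (add_le_add (hsplit s le_rfl) (hsplit 0 (by simp)))) hmain)
    _ ≤ (64 * m + C) * (b ^ 3 * (1 + |s|) ^ 3) := by nlinarith

lemma exists_abs_quadTail_expansion_le :
    ∃ C, 0 ≤ C ∧ ∀ {b u s : ℝ}, 0 < b → 0 < u →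
      |quadTail b u s - quadTail b u 0 - b ^ 2 * tailCoeff u s|
        ≤ C * (b ^ 3 * (1 + |s|) ^ 3) := by
  obtain ⟨C, hC, hnear⟩ := exists_abs_quadTail_expansion_le_of_le
  set C₁ : ℝ := 16 ^ 3 + 64 * (Nat.factorial 3 * Real.exp 2)
  set C₂ : ℝ := 64 ^ 4 * (∫ z, z ^ 4 ∂γ) + 64 * (Nat.factorial 4 * Real.exp 2)
  have hC₂0 : 0 ≤ C₂ := by
    have : 0 ≤ ∫ z, z ^ 4 ∂γ := integral_nonneg fun z => by positivity
    positivity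
  refine ⟨C₁ + C₂ + C, by positivity, fun {b u s} hb hu => ?_⟩
  have hC₁0 : 0 ≤ C₁ := by positivity
  have hy : 0 ≤ b ^ 3 * (1 + |s|) ^ 3 := by positivity
  rcases lt_or_ge (1 / 16) (b * (1 + |s|)) with hbs | hbs
  · exact (abs_quadTail_expansion_le_of_lt_one_add_abs hb hu hbs).trans
      (mul_le_mul_of_nonneg_right (by linarith) hy)
  rcases lt_or_ge (1 / 16) (b * u) with hbu | hbu
  · exact (abs_quadTail_expansion_le_of_lt_mul hb hu hbu hbs).trans
      (mul_le_mul_of_nonneg_right (by linarith) hy)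
  · exact (hnear hb hu hbu hbs).trans (mul_le_mul_of_nonneg_right (by linarith) hy)

end Expansion

end QuadraticTail

section IndependentPair

variable {Ω : Type*} [MeasurableSpace Ω] {P : Measure Ω} {Z S : Ω → ℝ} {b u : ℝ}

lemma measurable_quadTail (b u : ℝ) : Measurable (quadTail b u) :=
  (measurable_measure_prodMk_right (μ := γ) (s := {p : ℝ × ℝ | u ≤ |p.1 + b * (p.1 ^ 2 - p.2)|})
    (measurableSet_le (by fun_prop) (by fun_prop))).ennreal_toReal

lemma integral_quadTail_eq_of_indepFun [IsFiniteMeasure P] (hZ : HasLaw Z γ P)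
    (hS : AEMeasurable S P) (hZS : IndepFun Z S P) (b u : ℝ) :
    ∫ ω, quadTail b u (S ω) ∂P = P.real {ω | u ≤ |Z ω + b * (Z ω ^ 2 - S ω)|} := by
  have hE : MeasurableSet {p : ℝ × ℝ | u ≤ |p.1 + b * (p.1 ^ 2 - p.2)|} :=
    measurableSet_le (by fun_prop) (by fun_prop)
  have hjoint := (indepFun_iff_map_prod_eq_prod_map_map hZ.aemeasurable hS).1 hZS
  rw [hZ.map_eq] at hjoint
  calc ∫ ω, quadTail b u (S ω) ∂P = ∫ s, quadTail b u s ∂(P.map S) :=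
        (integral_map hS (measurable_quadTail b u).aestronglyMeasurable).symm
    _ = ((γ).prod (P.map S)).real {p : ℝ × ℝ | u ≤ |p.1 + b * (p.1 ^ 2 - p.2)|} := by
        rw [measureReal_def, Measure.prod_apply_symm hE]
        exact integral_toReal (measurable_measure_prodMk_right hE).aemeasurable
          (ae_of_all _ fun s => measure_lt_top _ _)
    _ = P.real {ω | u ≤ |Z ω + b * (Z ω ^ 2 - S ω)|} := by
        rw [← hjoint, map_measureReal_apply_of_aemeasurable (hZ.aemeasurable.prodMk hS) hE]
        rfl

variable [IsProbabilityMeasure P]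

lemma integrable_quadTail (hS : AEMeasurable S P) (b u : ℝ) :
    Integrable (fun ω => quadTail b u (S ω)) P := by
  refine (integrable_const 1).mono' ((measurable_quadTail b u).comp_aemeasurable
    hS).aestronglyMeasurable (ae_of_all _ fun ω => ?_)
  rw [quadTail, Real.norm_of_nonneg measureReal_nonneg]
  exact measureReal_le_one

lemma integrable_tailCoeff (hS : MemLp S 2 P) (u : ℝ) :
    Integrable (fun ω => tailCoeff u (S ω)) P := by
  have hS1 : Integrable S P := hS.integrable one_le_two
  exact ((hS.integrable_sq.add (hS1.const_mul 4)).sub (hS1.const_mul (2 * u ^ 2))).const_mul _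

lemma integrable_one_add_abs_pow {k : ℕ} (hS : MemLp S k P) :
    Integrable (fun ω => (1 + |S ω|) ^ k) P := by
  have hadd : MemLp (fun ω => 1 + |S ω|) k P := (memLp_const (1 : ℝ)).add hS.norm
  refine hadd.integrable_norm_pow'.congr (ae_of_all _ fun ω => ?_)
  simp only [Real.norm_eq_abs]
  rw [abs_of_nonneg (by positivity)]

lemma exists_abs_measureReal_sub_quadTail_le :
    ∃ C, 0 ≤ C ∧ ∀ {Ω : Type*} [MeasurableSpace Ω] {P : Measure Ω} [IsProbabilityMeasure P]
      {Z S : Ω → ℝ} {b u : ℝ}, HasLaw Z γ P → IndepFun Z S P → MemLp S 3 P → 0 < b → 0 < u →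
      |P.real {ω | u ≤ |Z ω + b * (Z ω ^ 2 - S ω)|} - quadTail b u 0
          - b ^ 2 * ∫ ω, tailCoeff u (S ω) ∂P| ≤ C * b ^ 3 * ∫ ω, (1 + |S ω|) ^ 3 ∂P := by
  obtain ⟨C, hC, hexpand⟩ := exists_abs_quadTail_expansion_le
  refine ⟨C, hC, fun {Ω _ P _ Z S b u} hZ hZS hS hb hu => ?_⟩
  have hmeas : AEMeasurable S P := hS.aestronglyMeasurable.aemeasurable
  have htail := integrable_quadTail hmeas b u
  have hchange : Integrable (fun ω => quadTail b u (S ω) - quadTail b u 0) P :=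
    htail.sub (integrable_const _)
  have hcoeff := (integrable_tailCoeff (hS.mono_exponent (by norm_num)) u).const_mul (b ^ 2)
  have hcube := integrable_one_add_abs_pow (k := 3) (by simpa only [Nat.cast_ofNat] using hS)
  calc _ = ‖∫ ω, (quadTail b u (S ω) - quadTail b u 0 - b ^ 2 * tailCoeff u (S ω)) ∂P‖ := by
        rw [integral_sub hchange hcoeff, integral_sub htail (integrable_const _),
          integral_const_mul, integral_const, probReal_univ, one_smul,
          integral_quadTail_eq_of_indepFun hZ hmeas hZS,
          Real.norm_eq_abs]
    _ ≤ ∫ ω, C * b ^ 3 * (1 + |S ω|) ^ 3 ∂P :=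
        norm_integral_le_of_norm_le (hcube.const_mul _) (ae_of_all _ fun ω => by
          simpa only [Real.norm_eq_abs, mul_assoc] using hexpand (s := S ω) hb hu)
    _ = C * b ^ 3 * ∫ ω, (1 + |S ω|) ^ 3 ∂P := integral_const_mul _ _

end IndependentPair

/-- The standardized mean `√n` times the sample mean. -/
noncomputable def stdMean (x : ℕ → ℝ) (n : ℕ) : ℝ := √n * sampleMean x n

section SampleStatistics

variable (x : ℕ → ℝ) {n : ℕ}

lemma sampleVar_nonneg (hn : 2 ≤ n) : 0 ≤ sampleVar x n := by
  have : (2 : ℝ) ≤ n := mod_cast hn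
  exact div_nonneg (Finset.sum_nonneg fun i _ => sq_nonneg _) (by linarith)

lemma sum_sq_eq_sampleVar_add_sq_stdMean (hn : 2 ≤ n) :
    ∑ i ∈ Finset.range n, x i ^ 2 = (n - 1) * sampleVar x n + stdMean x n ^ 2 := by
  have hn2 : (2 : ℝ) ≤ n := mod_cast hn
  have hn1 : (n : ℝ) - 1 ≠ 0 := by linarith
  have hsum : ∑ i ∈ Finset.range n, x i = n * sampleMean x n := by
    rw [sampleMean, mul_div_cancel₀ _ (by positivity)]
  rw [sampleVar, mul_div_cancel₀ _ hn1, stdMean, mul_pow, Real.sq_sqrt (by positivity)]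
  simp_rw [sub_sq, Finset.sum_add_distrib, Finset.sum_sub_distrib, ← Finset.sum_mul,
    ← Finset.mul_sum, hsum, Finset.sum_const, Finset.card_range, nsmul_eq_mul]
  ring

lemma sampleVar_pow_le (hn : 2 ≤ n) (k : ℕ) :
    sampleVar x n ^ k ≤ 2 ^ k * ∑ i ∈ Finset.range n, (n : ℝ)⁻¹ * x i ^ (2 * k) := by
  have hn2 : (2 : ℝ) ≤ n := mod_cast hn
  have hnonneg := sampleVar_nonneg x hn
  have hle : sampleVar x n ≤ 2 * ∑ i ∈ Finset.range n, (n : ℝ)⁻¹ * x i ^ 2 := by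
    rw [← Finset.mul_sum, sum_sq_eq_sampleVar_add_sq_stdMean x hn, mul_left_comm,
      le_inv_mul_iff₀ (by positivity)]
    nlinarith [sq_nonneg (stdMean x n)]
  calc sampleVar x n ^ k ≤ (2 * ∑ i ∈ Finset.range n, (n : ℝ)⁻¹ * x i ^ 2) ^ k := by gcongr
    _ = 2 ^ k * (∑ i ∈ Finset.range n, (n : ℝ)⁻¹ * x i ^ 2) ^ k := mul_pow _ _ _
    _ ≤ 2 ^ k * ∑ i ∈ Finset.range n, (n : ℝ)⁻¹ * (x i ^ 2) ^ k := by
        gcongr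
        exact Real.pow_arith_mean_le_arith_mean_pow _ _ _ (fun _ _ => by positivity)
          (by simp [(by positivity : (n : ℝ) ≠ 0)]) (fun _ _ => by positivity) k
    _ = _ := by simp_rw [← pow_mul]

end SampleStatistics

section StdNormalLaw

variable {Ω : Type*} [MeasurableSpace Ω] {P : Measure Ω} {Z : Ω → ℝ}

lemma variance_sq_of_hasLaw (hZ : HasLaw Z γ P) :
    Var[fun ω => Z ω ^ 2; P] = Var[fun z => z ^ 2; γ] := by
  rw [← hZ.map_eq, variance_map (by fun_prop) hZ.aemeasurable]
  rfl

lemma memLp_two_sq_of_hasLaw (hZ : HasLaw Z γ P) : MemLp (fun ω => Z ω ^ 2) 2 P := by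
  have hpow := integrable_pow_gaussianReal 0 1 4
  rw [← hZ.map_eq] at hpow
  rw [memLp_two_iff_integrable_sq (hZ.aemeasurable.pow_const 2).aestronglyMeasurable]
  exact (hpow.comp_aemeasurable hZ.aemeasurable).congr
    (ae_of_all _ fun ω => pow_mul (Z ω) 2 2)

end StdNormalLaw

/-- Independent standard normal observations. -/
structure IsStdNormalSample {Ω : Type*} [MeasurableSpace Ω] (Y : ℕ → Ω → ℝ) (P : Measure Ω) :
    Prop where
  indep : iIndepFun Y P
  law : ∀ i, HasLaw (Y i) γ P

namespace IsStdNormalSample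

variable {Ω : Type*} [MeasurableSpace Ω] {P : Measure Ω} {Y : ℕ → Ω → ℝ}

lemma aemeasurable (h : IsStdNormalSample Y P) (i : ℕ) : AEMeasurable (Y i) P :=
  (h.law i).aemeasurable

lemma memLp_two (h : IsStdNormalSample Y P) (i : ℕ) : MemLp (Y i) 2 P :=
  (h.law i).hasGaussianLaw.memLp_two

lemma integral_pow (h : IsStdNormalSample Y P) (i k : ℕ) :
    ∫ ω, Y i ω ^ k ∂P = ∫ z, z ^ k ∂γ :=
  (h.law i).integral_comp (f := fun z : ℝ => z ^ k) (by fun_prop)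

lemma integrable_pow (h : IsStdNormalSample Y P) (i k : ℕ) :
    Integrable (fun ω => Y i ω ^ k) P := by
  have hpow := integrable_pow_gaussianReal 0 1 k
  rw [← (h.law i).map_eq] at hpow
  exact hpow.comp_aemeasurable (h.aemeasurable i)

lemma covariance_eq (h : IsStdNormalSample Y P) (i j : ℕ) :
    cov[Y i, Y j; P] = if i = j then 1 else 0 := by
  split_ifs with hij
  · subst hij
    rw [covariance_self (h.aemeasurable i), (h.law i).variance_eq, variance_id_gaussianReal,
      NNReal.coe_one]
  · exact (h.indep.indepFun hij).covariance_eq_zero (h.memLp_two i) (h.memLp_two j)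

lemma aemeasurable_sampleMean (h : IsStdNormalSample Y P) (n : ℕ) :
    AEMeasurable (fun ω => sampleMean (fun i => Y i ω) n) P := by
  have := h.aemeasurable
  unfold sampleMean
  fun_prop

lemma aemeasurable_sampleVar (h : IsStdNormalSample Y P) (n : ℕ) :
    AEMeasurable (fun ω => sampleVar (fun i => Y i ω) n) P := by
  have := h.aemeasurable
  have := h.aemeasurable_sampleMean n
  unfold sampleVar
  fun_prop

lemma integrable_sum_pow (h : IsStdNormalSample Y P) (n k : ℕ) :
    Integrable (fun ω => ∑ i ∈ Finset.range n, (n : ℝ)⁻¹ * Y i ω ^ k) P :=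
  integrable_finsetSum _ fun i _ => (h.integrable_pow i k).const_mul _

lemma integrable_sampleVar_pow (h : IsStdNormalSample Y P) {n : ℕ} (hn : 2 ≤ n) (k : ℕ) :
    Integrable (fun ω => sampleVar (fun i => Y i ω) n ^ k) P := by
  refine ((h.integrable_sum_pow n (2 * k)).const_mul (2 ^ k)).mono'
    ((h.aemeasurable_sampleVar n).pow_const k).aestronglyMeasurable (ae_of_all _ fun ω => ?_)
  rw [Real.norm_of_nonneg (pow_nonneg (sampleVar_nonneg _ hn) k)]
  exact sampleVar_pow_le _ hn k

lemma integral_sampleVar_pow_le (h : IsStdNormalSample Y P) {n : ℕ} (hn : 2 ≤ n) (k : ℕ) :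
    ∫ ω, sampleVar (fun i => Y i ω) n ^ k ∂P ≤ 2 ^ k * ∫ z, z ^ (2 * k) ∂γ :=
  calc ∫ ω, sampleVar (fun i => Y i ω) n ^ k ∂P
      ≤ ∫ ω, 2 ^ k * ∑ i ∈ Finset.range n, (n : ℝ)⁻¹ * Y i ω ^ (2 * k) ∂P :=
        integral_mono (h.integrable_sampleVar_pow hn k)
          ((h.integrable_sum_pow n (2 * k)).const_mul _) fun ω => sampleVar_pow_le _ hn k
    _ = 2 ^ k * ∫ z, z ^ (2 * k) ∂γ := by
        rw [integral_const_mul,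
          integral_finsetSum _ fun i _ => (h.integrable_pow i (2 * k)).const_mul _]
        simp_rw [integral_const_mul, h.integral_pow, Finset.sum_const, Finset.card_range,
          nsmul_eq_mul]
        rw [mul_inv_cancel_left₀ (by positivity)]

lemma memLp_sampleVar (h : IsStdNormalSample Y P) {n : ℕ} (hn : 2 ≤ n) {k : ℕ} (hk : k ≠ 0) :
    MemLp (fun ω => sampleVar (fun i => Y i ω) n) k P := by
  rw [← integrable_norm_rpow_iff (h.aemeasurable_sampleVar n).aestronglyMeasurable
    (by exact_mod_cast hk) (ENNReal.natCast_ne_top k)]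
  refine (h.integrable_sampleVar_pow hn k).congr (ae_of_all _ fun ω => ?_)
  simp only [Real.norm_of_nonneg (sampleVar_nonneg _ hn), ENNReal.toReal_natCast,
    Real.rpow_natCast]

lemma variance_sum_sq (h : IsStdNormalSample Y P) (n : ℕ) :
    Var[fun ω => ∑ i ∈ Finset.range n, Y i ω ^ 2; P] = n * Var[fun z => z ^ 2; γ] := by
  have hindep : Set.Pairwise (Finset.range n : Set ℕ) fun i j =>
      IndepFun (fun ω => Y i ω ^ 2) (fun ω => Y j ω ^ 2) P := fun i _ j _ hij =>
    (h.indep.indepFun hij).comp (show Measurable fun y : ℝ => y ^ 2 by fun_prop)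
      (show Measurable fun y : ℝ => y ^ 2 by fun_prop)
  have hsum := IndepFun.variance_sum (fun i _ => memLp_two_sq_of_hasLaw (h.law i)) hindep
  simp_rw [variance_sq_of_hasLaw (h.law _), Finset.sum_const, Finset.card_range,
    nsmul_eq_mul] at hsum
  rw [← hsum]
  congr 1
  ext ω
  rw [Finset.sum_apply]

lemma hasGaussianLaw_sampleMean_prodMk_residual (h : IsStdNormalSample Y P) (n : ℕ) :
    HasGaussianLaw (fun ω => ((fun _ : Unit => sampleMean (fun i => Y i ω) n),
      (fun j : Fin n => Y j ω - sampleMean (fun i => Y i ω) n))) P := by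
  have hindep : iIndepFun (fun i : Fin n => Y i) P := h.indep.precomp Fin.val_injective
  have hjoint : HasGaussianLaw (fun ω (i : Fin n) => Y i ω) P :=
    hindep.hasGaussianLaw fun i => (h.law i).hasGaussianLaw
  let mean : (Fin n → ℝ) →L[ℝ] ℝ :=
    (n : ℝ)⁻¹ • ∑ i : Fin n, (ContinuousLinearMap.proj i : (Fin n → ℝ) →L[ℝ] ℝ)
  let L : (Fin n → ℝ) →L[ℝ] (Unit → ℝ) × (Fin n → ℝ) :=
    (ContinuousLinearMap.pi fun _ => mean).prod
      (ContinuousLinearMap.pi fun j => ContinuousLinearMap.proj j - mean)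
  convert! hjoint.map_fun L using 1
  ext ω j <;> simp [L, mean, sampleMean, Finset.sum_range, div_eq_inv_mul]

lemma hasGaussianLaw_sampleMean (h : IsStdNormalSample Y P) (n : ℕ) :
    HasGaussianLaw (fun ω => sampleMean (fun i => Y i ω) n) P :=
  (h.hasGaussianLaw_sampleMean_prodMk_residual n).fst.eval ()

variable [IsProbabilityMeasure P]

lemma covariance_sampleMean (h : IsStdNormalSample Y P) {n j : ℕ} (hj : j < n) :
    cov[fun ω => sampleMean (fun i => Y i ω) n, Y j; P] = (n : ℝ)⁻¹ := by
  simp_rw [sampleMean, div_eq_inv_mul]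
  rw [covariance_const_mul_left,
    covariance_fun_sum_left' (fun i _ => h.memLp_two i) (h.memLp_two j)]
  simp_rw [h.covariance_eq]
  simp [hj]

lemma variance_sampleMean (h : IsStdNormalSample Y P) {n : ℕ} (hn : 0 < n) :
    Var[fun ω => sampleMean (fun i => Y i ω) n; P] = (n : ℝ)⁻¹ := by
  have hmean : (fun ω => sampleMean (fun i => Y i ω) n)
      = fun ω => (n : ℝ)⁻¹ * ∑ i ∈ Finset.range n, Y i ω := by
    simp_rw [sampleMean, div_eq_inv_mul]
  rw [← covariance_self (h.aemeasurable_sampleMean n)]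
  nth_rw 2 [hmean]
  rw [covariance_const_mul_right, covariance_fun_sum_right' (fun i _ => h.memLp_two i)
    (h.hasGaussianLaw_sampleMean n).memLp_two,
    Finset.sum_congr rfl fun i hi => h.covariance_sampleMean (Finset.mem_range.1 hi)]
  simp [hn.ne']

lemma hasLaw_stdMean (h : IsStdNormalSample Y P) {n : ℕ} (hn : 0 < n) :
    HasLaw (fun ω => stdMean (fun i => Y i ω) n) γ P := by
  have hgauss : HasGaussianLaw (fun ω => stdMean (fun i => Y i ω) n) P :=
    (h.hasGaussianLaw_sampleMean n).fun_smul (√n)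
  have hmean : ∫ ω, stdMean (fun i => Y i ω) n ∂P = 0 := by
    unfold stdMean sampleMean
    rw [integral_const_mul, integral_div, integral_finsetSum _ fun i _ =>
      (h.memLp_two i).integrable one_le_two]
    simp [(h.law _).integral_eq]
  have hvar : Var[fun ω => stdMean (fun i => Y i ω) n; P] = 1 := by
    unfold stdMean
    rw [variance_const_mul, h.variance_sampleMean hn, Real.sq_sqrt (by positivity),
      mul_inv_cancel₀ (by positivity)]
  refine ⟨hgauss.aemeasurable, ?_⟩
  rw [hgauss.map_eq_gaussianReal, hmean, hvar, Real.toNNReal_one]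

lemma indepFun_stdMean_sampleVar (h : IsStdNormalSample Y P) (n : ℕ) :
    IndepFun (fun ω => stdMean (fun i => Y i ω) n) (fun ω => sampleVar (fun i => Y i ω) n) P := by
  have hresidual := (h.hasGaussianLaw_sampleMean_prodMk_residual n).indepFun_of_covariance_eval
    fun _ j => by
      rw [covariance_fun_sub_right (h.hasGaussianLaw_sampleMean n).memLp_two (h.memLp_two j)
        (h.hasGaussianLaw_sampleMean n).memLp_two, h.covariance_sampleMean j.2,
        covariance_self (h.aemeasurable_sampleMean n), h.variance_sampleMean (j.pos), sub_self]
  convert! hresidual.comp (show Measurable fun v : Unit → ℝ => √n * v () by fun_prop)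
    (show Measurable fun v : Fin n → ℝ => (∑ j, v j ^ 2) / ((n : ℝ) - 1) by fun_prop) using 1
  ext ω
  simp [sampleVar, Finset.sum_range]

lemma integral_sampleVar (h : IsStdNormalSample Y P) {n : ℕ} (hn : 2 ≤ n) :
    ∫ ω, sampleVar (fun i => Y i ω) n ∂P = 1 := by
  have hn2 : (2 : ℝ) ≤ n := mod_cast hn
  have hlaw := h.hasLaw_stdMean (by lia : 0 < n)
  have hint : Integrable (fun ω => ((n : ℝ) - 1) * sampleVar (fun i => Y i ω) n) P := by
    simpa only [pow_one] using (h.integrable_sampleVar_pow hn 1).const_mul ((n : ℝ) - 1)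
  have hsum : ∫ ω, ∑ i ∈ Finset.range n, Y i ω ^ 2 ∂P = n := by
    rw [integral_finsetSum _ fun i _ => h.integrable_pow i 2]
    simp [h.integral_pow, integral_sq_gaussianReal]
  have hmean : ∫ ω, stdMean (fun i => Y i ω) n ^ 2 ∂P = 1 :=
    (hlaw.integral_comp (f := fun z : ℝ => z ^ 2) (by fun_prop)).trans integral_sq_gaussianReal
  simp_rw [sum_sq_eq_sampleVar_add_sq_stdMean _ hn] at hsum
  rw [integral_add hint hlaw.hasGaussianLaw.memLp_two.integrable_sq, integral_const_mul,
    hmean] at hsum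
  exact mul_left_cancel₀ (by linarith : (n : ℝ) - 1 ≠ 0) (by linarith)

lemma variance_sampleVar (h : IsStdNormalSample Y P) {n : ℕ} (hn : 2 ≤ n) :
    Var[fun ω => sampleVar (fun i => Y i ω) n; P] = Var[fun z => z ^ 2; γ] / (n - 1) := by
  have hn2 : (2 : ℝ) ≤ n := mod_cast hn
  have hlaw := h.hasLaw_stdMean (by lia : 0 < n)
  have hmemVar : MemLp (fun ω => sampleVar (fun i => Y i ω) n) 2 P := by
    exact_mod_cast h.memLp_sampleVar hn two_ne_zero
  have hindep : IndepFun (fun ω => ((n : ℝ) - 1) * sampleVar (fun i => Y i ω) n)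
      (fun ω => stdMean (fun i => Y i ω) n ^ 2) P :=
    (h.indepFun_stdMean_sampleVar n).symm.comp
      (show Measurable fun w : ℝ => ((n : ℝ) - 1) * w by fun_prop)
      (show Measurable fun z : ℝ => z ^ 2 by fun_prop)
  have hsum := h.variance_sum_sq n
  simp_rw [sum_sq_eq_sampleVar_add_sq_stdMean _ hn] at hsum
  rw [hindep.variance_fun_add (hmemVar.const_mul _) (memLp_two_sq_of_hasLaw hlaw),
    variance_const_mul, variance_sq_of_hasLaw hlaw] at hsum
  have hcancel : ((n : ℝ) - 1) * Var[fun ω => sampleVar (fun i => Y i ω) n; P]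
      = Var[fun z => z ^ 2; γ] :=
    mul_left_cancel₀ (by linarith : (n : ℝ) - 1 ≠ 0) (by linear_combination hsum)
  rw [← hcancel, mul_div_cancel_left₀ _ (by linarith)]

lemma integral_sq_sampleVar (h : IsStdNormalSample Y P) {n : ℕ} (hn : 2 ≤ n) :
    ∫ ω, sampleVar (fun i => Y i ω) n ^ 2 ∂P = 1 + Var[fun z => z ^ 2; γ] / (n - 1) := by
  have hmem : MemLp (fun ω => sampleVar (fun i => Y i ω) n) 2 P := by
    exact_mod_cast h.memLp_sampleVar hn two_ne_zero
  have hvar := variance_eq_sub hmem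
  rw [h.variance_sampleVar hn, h.integral_sampleVar hn] at hvar
  simp only [Pi.pow_apply] at hvar
  linarith

end IsStdNormalSample

section RiemannSum

variable {F f f' : ℝ → ℝ} {A B C δ t : ℝ} {N : ℕ}

lemma abs_sub_sub_mul_le_of_hasDerivAt (hF : ∀ t > 0, HasDerivAt F (f t) t)
    (hf : ∀ t > 0, HasDerivAt f (f' t) t) (hC : ∀ t > 0, |f' t| ≤ C / t ^ 2) (ht : 0 < t)
    (hδ : 0 ≤ δ) : |F (t + δ) - F t - δ * f t| ≤ C * (δ / t) ^ 2 := by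
  have hCnonneg : 0 ≤ C := by simpa using (abs_nonneg _).trans (hC 1 one_pos)
  have hlip {s : ℝ} (hs : s ∈ Set.Icc t (t + δ)) : ‖f s - f t‖ ≤ C / t ^ 2 * δ := by
    have hbound := (convex_Icc t (t + δ)).norm_image_sub_le_of_norm_hasDerivWithin_le
      (fun r hr => (hf r (ht.trans_le hr.1)).hasDerivWithinAt)
      (fun r hr => (hC r (ht.trans_le hr.1)).trans (show C / r ^ 2 ≤ C / t ^ 2 by
        have := hr.1
        gcongr)) (Set.left_mem_Icc.2 (by linarith)) hs
    refine hbound.trans ?_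
    rw [Real.norm_of_nonneg (sub_nonneg.2 hs.1)]
    gcongr
    linarith [hs.2]
  have htaylor := (convex_Icc t (t + δ)).norm_image_sub_le_of_norm_hasDerivWithin_le
    (f := fun s => F s - s * f t) (fun s hs => ((hF s (ht.trans_le hs.1)).sub
      ((hasDerivAt_id s).mul_const (f t))).hasDerivWithinAt)
    (fun s hs => by simpa only [one_mul] using hlip hs)
    (Set.left_mem_Icc.2 (by linarith)) (Set.right_mem_Icc.2 (by linarith))
  calc |F (t + δ) - F t - δ * f t|
      = ‖F (t + δ) - (t + δ) * f t - (F t - t * f t)‖ := by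
        rw [Real.norm_eq_abs]
        ring_nf
    _ ≤ C / t ^ 2 * δ * ‖t + δ - t‖ := htaylor
    _ = C * (δ / t) ^ 2 := by
        rw [add_sub_cancel_left, Real.norm_of_nonneg hδ]
        ring

lemma abs_tsum_mul_sub_le (hF : ∀ t > 0, HasDerivAt F (f t) t)
    (hf : ∀ t > 0, HasDerivAt f (f' t) t) (hfC : ∀ t > 0, |f t| ≤ C / t ^ 2)
    (hC : ∀ t > 0, |f' t| ≤ C / t ^ 2) (hB : Tendsto F atTop (𝓝 B)) (hδ : 0 < δ) (hN : 0 < N) :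
    |∑' k : ℕ, δ * f (δ * (k + N : ℕ)) - (B - F (δ * N))|
      ≤ C * ∑' k : ℕ, 1 / ((k + N : ℕ) : ℝ) ^ 2 := by
  have hpos (k : ℕ) : 0 < δ * (k + N : ℕ) := by
    have : 0 < k + N := by lia
    positivity
  have hsum : Summable fun k : ℕ => 1 / ((k + N : ℕ) : ℝ) ^ 2 :=
    (summable_nat_add_iff N).2 (Real.summable_one_div_nat_pow.2 one_lt_two)
  have hriemann : Summable fun k : ℕ => δ * f (δ * (k + N : ℕ)) := by
    refine .of_norm_bounded (hsum.mul_left (C / δ)) fun k => ?_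
    rw [norm_mul, Real.norm_of_nonneg hδ.le, Real.norm_eq_abs]
    refine (mul_le_mul_of_nonneg_left (hfC _ (hpos k)) hδ.le).trans_eq ?_
    field_simp
  have hstep (k : ℕ) : ‖δ * f (δ * (k + N : ℕ)) - (F (δ * (k + 1 + N : ℕ)) - F (δ * (k + N : ℕ)))‖
      ≤ C * (1 / ((k + N : ℕ) : ℝ) ^ 2) := by
    have htaylor := abs_sub_sub_mul_le_of_hasDerivAt hF hf hC (hpos k) hδ.le
    rw [← abs_neg] at htaylor
    convert! htaylor using 1
    · rw [Real.norm_eq_abs]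
      push_cast
      ring_nf
    · field_simp
  have herror := Summable.of_norm_bounded (hsum.mul_left C) hstep
  have htelescope : HasSum (fun k : ℕ => F (δ * (k + 1 + N : ℕ)) - F (δ * (k + N : ℕ)))
      (B - F (δ * N)) := by
    have hs : Summable fun k : ℕ => F (δ * (k + 1 + N : ℕ)) - F (δ * (k + N : ℕ)) :=
      (hriemann.sub herror).congr fun k => by ring
    rw [hs.hasSum_iff_tendsto_nat]
    simp_rw [Finset.sum_range_sub fun k : ℕ => F (δ * (k + N : ℕ)), zero_add]
    exact (hB.comp (.const_mul_atTop hδ (tendsto_natCast_atTop_atTop.comp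
      (tendsto_add_atTop_nat N)))).sub_const _
  rw [← htelescope.tsum_eq, ← hriemann.tsum_sub htelescope.summable, ← Real.norm_eq_abs,
    ← tsum_mul_left]
  exact tsum_of_norm_bounded (hsum.mul_left C).hasSum hstep

lemma tendsto_tsum_mul_of_hasDerivAt {ι : Type*} {l : Filter ι} {δ : ι → ℝ} {N : ι → ℕ}
    (hF : ∀ t > 0, HasDerivAt F (f t) t) (hf : ∀ t > 0, HasDerivAt f (f' t) t)
    (hfC : ∀ t > 0, |f t| ≤ C / t ^ 2) (hC : ∀ t > 0, |f' t| ≤ C / t ^ 2)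
    (hA : Tendsto F (𝓝[>] 0) (𝓝 A)) (hB : Tendsto F atTop (𝓝 B)) (hδ : ∀ᶠ i in l, 0 < δ i)
    (hN : Tendsto N l atTop) (hδN : Tendsto (fun i => δ i * N i) l (𝓝 0)) :
    Tendsto (fun i => ∑' k : ℕ, δ i * f (δ i * (k + N i : ℕ))) l (𝓝 (B - A)) := by
  have htail : Tendsto (fun i => C * ∑' k : ℕ, 1 / ((k + N i : ℕ) : ℝ) ^ 2) l (𝓝 0) := by
    simpa only [mul_zero, Function.comp_apply] using
      ((tendsto_sum_nat_add fun n : ℕ => 1 / (n : ℝ) ^ 2).comp hN).const_mul C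
  have hstart : Tendsto (fun i => δ i * N i) l (𝓝[>] 0) := by
    refine tendsto_nhdsWithin_iff.2 ⟨hδN, ?_⟩
    filter_upwards [hδ, hN.eventually_gt_atTop 0] with i hi hNi
    exact mul_pos hi (Nat.cast_pos.2 hNi)
  have herror : Tendsto (fun i => ∑' k : ℕ, δ i * f (δ i * (k + N i : ℕ))
      - (B - F (δ i * N i))) l (𝓝 0) := by
    refine squeeze_zero_norm' ?_ htail
    filter_upwards [hδ, hN.eventually_gt_atTop 0] with i hi hNi
    exact abs_tsum_mul_sub_le hF hf hfC hC hB hi hNi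
  simpa only [Function.comp_apply, sub_add_cancel, zero_add] using
    herror.add ((hA.comp hstart).const_sub B)

end RiemannSum

section EventCount

variable {Ω ι : Type*} {S : ι → Set Ω}

lemma toReal_tsum_indicator_eq_ncard (S : ι → Set Ω) (ω : Ω) :
    (∑' i, (S i).indicator (fun _ => (1 : ENNReal)) ω).toReal = {i | ω ∈ S i}.ncard := by
  have hencard : ∑' i, (S i).indicator (fun _ => (1 : ENNReal)) ω = {i | ω ∈ S i}.encard := by
    rw [← ENNReal.tsum_set_one, tsum_subtype {i | ω ∈ S i} fun _ => 1]
    rfl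
  rw [hencard, Set.ncard]
  cases {i | ω ∈ S i}.encard <;> simp

variable [MeasurableSpace Ω] {P : Measure Ω} [Countable ι]

lemma aemeasurable_tsum_indicator (hS : ∀ i, NullMeasurableSet (S i) P) :
    AEMeasurable (fun ω => ∑' i, (S i).indicator (fun _ => (1 : ENNReal)) ω) P :=
  .tsum fun i => aemeasurable_const.indicator₀ (hS i)

variable [IsFiniteMeasure P]

lemma ae_finite_of_summable_measureReal (hsum : Summable fun i => P.real (S i)) :
    ∀ᵐ ω ∂P, {i | ω ∈ S i}.Finite :=
  ae_finite_setOfPred_mem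
    ((tsum_congr fun _ => (ofReal_measureReal).symm).trans_ne hsum.tsum_ofReal_ne_top)

lemma lintegral_tsum_indicator (hS : ∀ i, NullMeasurableSet (S i) P)
    (hsum : Summable fun i => P.real (S i)) :
    ∫⁻ ω, ∑' i, (S i).indicator (fun _ => 1) ω ∂P = ENNReal.ofReal (∑' i, P.real (S i)) := by
  rw [lintegral_tsum fun i => aemeasurable_const.indicator₀ (hS i),
    ENNReal.ofReal_tsum_of_nonneg (fun i => measureReal_nonneg) hsum]
  exact tsum_congr fun i => by
    rw [lintegral_indicator_const₀ (hS i), one_mul, ofReal_measureReal]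

lemma integrable_ncard (hS : ∀ i, NullMeasurableSet (S i) P)
    (hsum : Summable fun i => P.real (S i)) :
    Integrable (fun ω => ({i | ω ∈ S i}.ncard : ℝ)) P := by
  simp_rw [← toReal_tsum_indicator_eq_ncard]
  exact integrable_toReal_of_lintegral_ne_top (aemeasurable_tsum_indicator hS)
    ((lintegral_tsum_indicator hS hsum).trans_ne ENNReal.ofReal_ne_top)

lemma integral_ncard (hS : ∀ i, NullMeasurableSet (S i) P)
    (hsum : Summable fun i => P.real (S i)) :
    ∫ ω, ({i | ω ∈ S i}.ncard : ℝ) ∂P = ∑' i, P.real (S i) := by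
  have hlint := lintegral_tsum_indicator hS hsum
  have hmeas := aemeasurable_tsum_indicator hS
  simp_rw [← toReal_tsum_indicator_eq_ncard]
  rw [integral_toReal hmeas (ae_lt_top' hmeas (hlint.trans_ne ENNReal.ofReal_ne_top)), hlint,
    ENNReal.toReal_ofReal (tsum_nonneg fun i => measureReal_nonneg)]

end EventCount

/-- With `t = κ² n`, changing the constant of the estimator from `0` to `d` changes the probability
of a miss at sample size `n` by `(τ² / 2) κ² missGain d t` up to an error of order `n ^ (-3 / 2)`,
where `τ` is the coefficient of variation and `κ` the standardized tolerance. -/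
noncomputable def missGain (d t : ℝ) : ℝ := φ √t * (d ^ 2 + 4 * d - 2 * d * t) / (2 * √t)

/-- The derivative of `missGain d`. -/
noncomputable def missGainDeriv (d t : ℝ) : ℝ :=
  φ √t * -((t + 1) * (d ^ 2 + 4 * d - 2 * d * t) + 4 * d * t) / (4 * t * √t)

/-- The antiderivative of `missGain d` on `(0, ∞)`. -/
noncomputable def missGainPrimitive (d t : ℝ) : ℝ :=
  (d ^ 2 + 2 * d) * cdf γ √t + 2 * d * (√t * φ √t)

section MissGain

variable (d : ℝ) {t : ℝ}

lemma hasDerivAt_stdGaussianPDF_sqrt (ht : 0 < t) :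
    HasDerivAt (fun t => φ √t) (-(φ √t) / 2) t := by
  have hcomp := (hasDerivAt_gaussianPDFReal 0 1 √t).comp t (Real.hasDerivAt_sqrt ht.ne')
  convert! hcomp using 1
  have : √t ≠ 0 := by positivity
  rw [NNReal.coe_one]
  field_simp
  ring

lemma hasDerivAt_missGainPrimitive (ht : 0 < t) :
    HasDerivAt (missGainPrimitive d) (missGain d t) t := by
  have hsqrt := Real.hasDerivAt_sqrt ht.ne'
  have hcdf := (hasDerivAt_cdf_gaussianReal 0 one_ne_zero √t).comp t hsqrt
  convert! (hcdf.const_mul (d ^ 2 + 2 * d)).add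
    ((hsqrt.mul (hasDerivAt_stdGaussianPDF_sqrt ht)).const_mul (2 * d)) using 1
  have hsq : √t ^ 2 = t := Real.sq_sqrt ht.le
  have : √t ≠ 0 := by positivity
  rw [missGain, ← hsq, Real.sqrt_sq (Real.sqrt_nonneg t)]
  field_simp
  ring

lemma hasDerivAt_missGain (ht : 0 < t) : HasDerivAt (missGain d) (missGainDeriv d t) t := by
  have hpoly : HasDerivAt (fun t : ℝ => d ^ 2 + 4 * d - 2 * d * t) (-(2 * d)) t := by
    simpa only [mul_one] using ((hasDerivAt_id' t).const_mul (2 * d)).const_sub (d ^ 2 + 4 * d)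
  have hsqrt := (Real.hasDerivAt_sqrt ht.ne').const_mul 2
  convert! ((hasDerivAt_stdGaussianPDF_sqrt ht).fun_mul hpoly).div hsqrt (by positivity) using 1
  have hsq : √t ^ 2 = t := Real.sq_sqrt ht.le
  have : √t ≠ 0 := by positivity
  rw [missGainDeriv, ← hsq, Real.sqrt_sq (Real.sqrt_nonneg t)]
  field_simp
  ring

lemma exists_abs_missGain_le :
    ∃ C, ∀ t > 0, |missGain d t| ≤ C / t ^ 2 ∧ |missGainDeriv d t| ≤ C / t ^ 2 := by
  refine ⟨(|d ^ 2 + 4 * d| + |d|) * (Nat.factorial 5 * Real.exp 2), fun t ht => ?_⟩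
  obtain ⟨s, hs, rfl⟩ : ∃ s > 0, t = s ^ 2 := ⟨√t, by positivity, (Real.sq_sqrt ht.le).symm⟩
  have hsqrt : √(s ^ 2) = s := Real.sqrt_sq hs.le
  have hbound {p q : ℝ} (hp : |p| ≤ (1 + s) ^ 5) (hq : |q| ≤ (1 + s) ^ 5) :
      |φ s * ((d ^ 2 + 4 * d) * p + d * q) / (s ^ 2) ^ 2|
        ≤ (|d ^ 2 + 4 * d| + |d|) * (Nat.factorial 5 * Real.exp 2) / (s ^ 2) ^ 2 := by
    have hgauss := stdGaussianPDF_mul_one_add_abs_pow_le s 5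
    have hφ := gaussianPDFReal_nonneg 0 1 s
    rw [abs_of_pos hs] at hgauss
    rw [abs_div, abs_mul, abs_of_nonneg hφ, abs_of_pos (by positivity : 0 < (s ^ 2) ^ 2)]
    refine div_le_div_of_nonneg_right ?_ (by positivity)
    calc φ s * |(d ^ 2 + 4 * d) * p + d * q|
        ≤ φ s * (|d ^ 2 + 4 * d| * (1 + s) ^ 5 + |d| * (1 + s) ^ 5) := by
          refine mul_le_mul_of_nonneg_left ((abs_add_le _ _).trans ?_) hφ
          rw [abs_mul, abs_mul]
          gcongr
      _ = (|d ^ 2 + 4 * d| + |d|) * (φ s * (1 + s) ^ 5) := by ring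
      _ ≤ _ := by gcongr
  have : (1 + s) ^ 5 = 1 + 5 * s + 10 * s ^ 2 + 10 * s ^ 3 + 5 * s ^ 4 + s ^ 5 := by ring
  have := pow_pos hs 2
  have := pow_pos hs 3
  have := pow_pos hs 4
  have := pow_pos hs 5
  constructor
  · convert! hbound (p := s ^ 3 / 2) (q := -s ^ 5) (abs_le.2 ⟨by linarith, by linarith⟩)
      (abs_le.2 ⟨by linarith, by linarith⟩) using 2
    rw [missGain, hsqrt]
    field_simp
    ring
  · convert! hbound (p := -(s ^ 3 + s) / 4) (q := (s ^ 5 - s ^ 3) / 2)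
      (abs_le.2 ⟨by linarith, by linarith⟩) (abs_le.2 ⟨by linarith, by linarith⟩) using 2
    rw [missGainDeriv, hsqrt]
    field_simp
    ring

lemma tendsto_missGainPrimitive_zero :
    Tendsto (missGainPrimitive d) (𝓝[>] 0) (𝓝 ((d ^ 2 + 2 * d) / 2)) := by
  have hcont : ContinuousAt (missGainPrimitive d) 0 := by
    have hcdf : ContinuousAt (fun t => cdf γ √t) 0 :=
      (hasDerivAt_cdf_gaussianReal 0 one_ne_zero √0).continuousAt.comp
        Real.continuous_sqrt.continuousAt
    have hpdf : ContinuousAt (fun t => √t * φ √t) 0 :=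
      (Real.continuous_sqrt.mul
        ((continuous_gaussianPDFReal 0 1).comp Real.continuous_sqrt)).continuousAt
    exact (hcdf.const_mul _).add (hpdf.const_mul _)
  convert! hcont.tendsto.mono_left nhdsWithin_le_nhds using 2
  rw [missGainPrimitive, Real.sqrt_zero, cdf_gaussianReal_zero]
  ring

lemma tendsto_missGainPrimitive_atTop :
    Tendsto (missGainPrimitive d) atTop (𝓝 (d ^ 2 + 2 * d)) := by
  have hpdf : Tendsto (fun x => x * φ x) atTop (𝓝 0) := by
    have hinv : Tendsto (fun x : ℝ => Nat.factorial 2 * Real.exp 2 * x⁻¹) atTop (𝓝 0) := by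
      simpa only [mul_zero] using tendsto_inv_atTop_zero.const_mul (Nat.factorial 2 * Real.exp 2)
    refine squeeze_zero' ?_ ?_ hinv
    all_goals filter_upwards [eventually_gt_atTop 0] with x hx
    · exact mul_nonneg hx.le (gaussianPDFReal_nonneg 0 1 x)
    · have hgauss := stdGaussianPDF_mul_one_add_abs_pow_le x 2
      have hφ := gaussianPDFReal_nonneg 0 1 x
      rw [abs_of_pos hx] at hgauss
      rw [← div_eq_mul_inv, le_div_iff₀ hx]
      nlinarith [mul_nonneg hφ hx.le]
  have hlim := ((tendsto_cdf_atTop γ).const_mul (d ^ 2 + 2 * d)).add (hpdf.const_mul (2 * d))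
  rw [mul_one, mul_zero, add_zero] at hlim
  exact hlim.comp Real.tendsto_sqrt_atTop

end MissGain

/-- The error of the estimator with constant `d` in units of its asymptotic standard deviation
`2 τ ξ² / √n`, where `y` are the standardized observations and `τ` is the coefficient of variation
(see `sqMeanEstimator_sub_sq`). -/
noncomputable def stdError (d τ : ℝ) (y : ℕ → ℝ) (n : ℕ) : ℝ :=
  stdMean y n + τ / (2 * √n) * (stdMean y n ^ 2 - d * sampleVar y n)

/-- The probability that the estimator with constant `d` misses its target by at least `κ` times
`2 τ ξ²` when based on `n` observations. -/
noncomputable def missProb {Ω : Type*} [MeasurableSpace Ω] (P : Measure Ω) (Y : ℕ → Ω → ℝ)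
    (d τ κ : ℝ) (n : ℕ) : ℝ :=
  P.real {ω | κ * √n ≤ |stdError d τ (fun i => Y i ω) n|}

namespace IsStdNormalSample

variable {Ω : Type*} [MeasurableSpace Ω] {P : Measure Ω} {Y : ℕ → Ω → ℝ} {d τ κ : ℝ} {n : ℕ}
  [IsProbabilityMeasure P]

lemma integral_tailCoeff_sampleVar (h : IsStdNormalSample Y P) (hn : 2 ≤ n) (d u : ℝ) :
    ∫ ω, tailCoeff u (d * sampleVar (fun i => Y i ω) n) ∂P
      = φ u * u * (d ^ 2 * (1 + Var[fun z => z ^ 2; γ] / (n - 1)) + 4 * d - 2 * u ^ 2 * d) := by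
  have hsq : Integrable (fun ω => d ^ 2 * sampleVar (fun i => Y i ω) n ^ 2) P :=
    (h.integrable_sampleVar_pow hn 2).const_mul _
  have hvar : Integrable (fun ω => (4 * d - 2 * u ^ 2 * d) * sampleVar (fun i => Y i ω) n) P := by
    simpa only [pow_one] using (h.integrable_sampleVar_pow hn 1).const_mul (4 * d - 2 * u ^ 2 * d)
  calc _ = ∫ ω, φ u * u * (d ^ 2 * sampleVar (fun i => Y i ω) n ^ 2
        + (4 * d - 2 * u ^ 2 * d) * sampleVar (fun i => Y i ω) n) ∂P := by
        congr with ω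
        rw [tailCoeff]
        ring
    _ = _ := by
        rw [integral_const_mul, integral_add hsq hvar, integral_const_mul, integral_const_mul,
          h.integral_sq_sampleVar hn, h.integral_sampleVar hn]
        ring

lemma integral_one_add_abs_sampleVar_pow_le (h : IsStdNormalSample Y P) (hn : 2 ≤ n) (d : ℝ) :
    ∫ ω, (1 + |d * sampleVar (fun i => Y i ω) n|) ^ 3 ∂P
      ≤ 4 * (1 + |d| ^ 3 * (8 * ∫ z, z ^ 6 ∂γ)) := by
  have hcube : Integrable (fun ω => |d| ^ 3 * sampleVar (fun i => Y i ω) n ^ 3) P :=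
    (h.integrable_sampleVar_pow hn 3).const_mul _
  have hmoment : ∫ ω, sampleVar (fun i => Y i ω) n ^ 3 ∂P ≤ 8 * ∫ z, z ^ 6 ∂γ :=
    (h.integral_sampleVar_pow_le hn 3).trans_eq (by norm_num)
  calc ∫ ω, (1 + |d * sampleVar (fun i => Y i ω) n|) ^ 3 ∂P
      ≤ ∫ ω, 4 * (1 + |d| ^ 3 * sampleVar (fun i => Y i ω) n ^ 3) ∂P := by
        refine integral_mono_of_nonneg (ae_of_all _ fun ω => by positivity)
          (((integrable_const 1).add hcube).const_mul 4) (ae_of_all _ fun ω => ?_)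
        have hpow := add_pow_le zero_le_one (abs_nonneg (d * sampleVar (fun i => Y i ω) n)) 3
        rw [abs_mul, mul_pow, abs_of_nonneg (sampleVar_nonneg _ hn)] at hpow
        norm_num at hpow
        simpa only [abs_mul, abs_of_nonneg (sampleVar_nonneg _ hn)] using hpow
    _ = 4 * (1 + |d| ^ 3 * ∫ ω, sampleVar (fun i => Y i ω) n ^ 3 ∂P) := by
        rw [integral_const_mul, integral_add (integrable_const 1) hcube, integral_const_mul,
          integral_const, probReal_univ, one_smul]
    _ ≤ _ := by gcongr

lemma abs_sq_mul_integral_tailCoeff_sub_le (h : IsStdNormalSample Y P) (d τ : ℝ) (hκ : 0 < κ)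
    (hn : 2 ≤ n) :
    |(τ / (2 * √n)) ^ 2 * ∫ ω, tailCoeff (κ * √n) (d * sampleVar (fun i => Y i ω) n) ∂P
        - τ ^ 2 / 2 * (κ ^ 2 * missGain d (κ ^ 2 * n))|
      ≤ τ ^ 2 / 2 * Real.exp 2 * d ^ 2 * Var[fun z => z ^ 2; γ] / (n * √n) := by
  have hn2 : (2 : ℝ) ≤ n := mod_cast hn
  have hn1 : 0 < (n : ℝ) - 1 := by linarith
  have hr : 0 < √(n : ℝ) := by positivity
  have hr2 : √(n : ℝ) ^ 2 = n := Real.sq_sqrt (by positivity)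
  have hgain : κ ^ 2 * missGain d (κ ^ 2 * n) = κ * φ (κ * √n)
      * (d ^ 2 + 4 * d - 2 * (κ * √n) ^ 2 * d) / (2 * √n) := by
    rw [missGain, Real.sqrt_mul (by positivity), Real.sqrt_sq hκ.le, mul_pow, hr2]
    field_simp
  have hφ : |φ (κ * √n) * (κ * √n)| ≤ Real.exp 2 := by
    have hgauss := stdGaussianPDF_mul_one_add_abs_pow_le (κ * √n) 1
    have hpdf := gaussianPDFReal_nonneg 0 1 (κ * √n)
    have hu : 0 < κ * √n := by positivity
    rw [Nat.factorial_one, Nat.cast_one, one_mul, pow_one, abs_of_pos hu] at hgauss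
    rw [abs_of_nonneg (by positivity)]
    linarith
  have hv := variance_nonneg (fun z : ℝ => z ^ 2) γ
  calc _ = |φ (κ * √n) * (κ * √n)| *
        (τ ^ 2 / (4 * n) * d ^ 2 * Var[fun z => z ^ 2; γ] / (n - 1)) := by
        rw [← abs_of_nonneg (by positivity :
          0 ≤ τ ^ 2 / (4 * n) * d ^ 2 * Var[fun z => z ^ 2; γ] / (n - 1)), ← abs_mul,
          h.integral_tailCoeff_sampleVar hn, hgain]
        congr 1
        generalize √(n : ℝ) = r at *
        rw [← hr2] at hn1 ⊢
        have := hn1.ne'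
        field_simp
        ring
    _ ≤ Real.exp 2 * (τ ^ 2 / (4 * n) * d ^ 2 * Var[fun z => z ^ 2; γ] / (√n / 2)) := by
        gcongr
        nlinarith [Real.one_le_sqrt.2 (by linarith : (1 : ℝ) ≤ n)]
    _ = _ := by
        field_simp
        ring

lemma exists_abs_missProb_sub_quadTail_le (h : IsStdNormalSample Y P) (d : ℝ) (hτ : 0 < τ) :
    ∃ C, ∀ κ > 0, ∀ n : ℕ, 2 ≤ n →
      |missProb P Y d τ κ n - quadTail (τ / (2 * √n)) (κ * √n) 0
        - τ ^ 2 / 2 * (κ ^ 2 * missGain d (κ ^ 2 * n))| ≤ C / (n * √n) := by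
  obtain ⟨C, hC, hexpand⟩ := exists_abs_measureReal_sub_quadTail_le
  refine ⟨C * (τ ^ 3 / 8) * (4 * (1 + |d| ^ 3 * (8 * ∫ z, z ^ 6 ∂γ)))
    + τ ^ 2 / 2 * Real.exp 2 * d ^ 2 * Var[fun z => z ^ 2; γ], fun κ hκ n hn => ?_⟩
  have hr : 0 < √(n : ℝ) := by positivity
  have hS : MemLp (fun ω => d * sampleVar (fun i => Y i ω) n) 3 P := by
    exact_mod_cast (h.memLp_sampleVar hn three_ne_zero).const_mul d
  have hindep : IndepFun (fun ω => stdMean (fun i => Y i ω) n)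
      (fun ω => d * sampleVar (fun i => Y i ω) n) P :=
    (h.indepFun_stdMean_sampleVar n).comp measurable_id
      (show Measurable fun w : ℝ => d * w by fun_prop)
  have hquad := hexpand (b := τ / (2 * √n)) (u := κ * √n) (h.hasLaw_stdMean (by lia)) hindep hS
    (by positivity) (by positivity)
  have hquad' := hquad.trans (mul_le_mul_of_nonneg_left
    (h.integral_one_add_abs_sampleVar_pow_le hn d) (by positivity))
  have hb3 : (τ / (2 * √n)) ^ 3 = τ ^ 3 / 8 / (n * √n) := by
    have hr2 : √(n : ℝ) ^ 2 = n := Real.sq_sqrt (by positivity)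
    rw [← hr2, Real.sqrt_sq hr.le]
    field_simp
    norm_num
  have hcoeff := h.abs_sq_mul_integral_tailCoeff_sub_le d τ hκ hn
  refine (abs_sub_le _ ((τ / (2 * √n)) ^ 2 *
    ∫ ω, tailCoeff (κ * √n) (d * sampleVar (fun i => Y i ω) n) ∂P) _).trans
    ((add_le_add hquad' hcoeff).trans_eq ?_)
  rw [hb3]
  ring

lemma exists_abs_missProb_sub_le (h : IsStdNormalSample Y P) (d : ℝ) (hτ : 0 < τ) :
    ∃ C, ∀ κ > 0, ∀ n : ℕ, 2 ≤ n → |missProb P Y d τ κ n - missProb P Y 0 τ κ n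
      - τ ^ 2 / 2 * (κ ^ 2 * missGain d (κ ^ 2 * n))| ≤ C / (n * √n) := by
  obtain ⟨C, hC⟩ := h.exists_abs_missProb_sub_quadTail_le d hτ
  obtain ⟨C₀, hC₀⟩ := h.exists_abs_missProb_sub_quadTail_le 0 hτ
  refine ⟨C + C₀, fun κ hκ n hn => ?_⟩
  have hgain : missGain 0 (κ ^ 2 * n) = 0 := by simp [missGain]
  have hzero := hC₀ κ hκ n hn
  rw [hgain, mul_zero, mul_zero, sub_zero, abs_sub_comm] at hzero
  rw [add_div]
  refine le_trans (le_of_eq ?_) ((abs_add_le _ _).trans (add_le_add (hC κ hκ n hn) hzero))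
  ring_nf

end IsStdNormalSample

lemma summable_one_div_mul_sqrt : Summable fun n : ℕ => 1 / (n * √n : ℝ) := by
  refine (Real.summable_one_div_nat_rpow.2 (by norm_num : (1 : ℝ) < 3 / 2)).congr fun n => ?_
  rcases n.eq_zero_or_pos with rfl | hn
  · simp
  · rw [show (3 / 2 : ℝ) = 1 + 1 / 2 by norm_num, Real.rpow_add (by positivity), Real.rpow_one,
      Real.sqrt_eq_rpow]

lemma quadTail_zero_le (b : ℝ) {u : ℝ} (hu : 0 < u) :
    quadTail b u 0 ≤ 8 * (∫ z, z ^ 4 ∂γ + b ^ 4 * ∫ z, z ^ 8 ∂γ) / u ^ 4 := by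
  have h4 := integrable_pow_gaussianReal 0 1 4
  have h8 := (integrable_pow_gaussianReal 0 1 8).const_mul (b ^ 4)
  have hle (z : ℝ) : ((z + b * z ^ 2) / u) ^ 4 ≤ 8 / u ^ 4 * (z ^ 4 + b ^ 4 * z ^ 8) := by
    have hpow : (z + b * z ^ 2) ^ 4 ≤ 8 * (z ^ 4 + (b * z ^ 2) ^ 4) := by
      have := (show Even 4 by decide).add_pow_le (a := z) (b := b * z ^ 2)
      norm_num at this
      exact this
    calc _ = (z + b * z ^ 2) ^ 4 / u ^ 4 := div_pow _ _ _
      _ ≤ 8 * (z ^ 4 + (b * z ^ 2) ^ 4) / u ^ 4 := by gcongr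
      _ = _ := by ring
  have hbound : Integrable (fun z => 8 / u ^ 4 * (z ^ 4 + b ^ 4 * z ^ 8)) γ :=
    (h4.add h8).const_mul _
  have hint : Integrable (fun z => ((z + b * z ^ 2) / u) ^ 4) γ :=
    hbound.mono' (by fun_prop) (ae_of_all _ fun z => by
      rw [Real.norm_of_nonneg (by positivity)]
      exact hle z)
  calc quadTail b u 0 = (γ).real {z | 1 ≤ |(z + b * z ^ 2) / u|} := by
        simp_rw [quadTail, sub_zero, abs_div, abs_of_pos hu, one_le_div hu]
    _ ≤ ∫ z, ((z + b * z ^ 2) / u) ^ 4 ∂γ := measureReal_one_le_abs_le_integral_pow_four hint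
    _ ≤ ∫ z, 8 / u ^ 4 * (z ^ 4 + b ^ 4 * z ^ 8) ∂γ := integral_mono hint hbound hle
    _ = _ := by
        rw [integral_const_mul, integral_add h4 h8, integral_const_mul]
        ring

namespace IsStdNormalSample

variable {Ω : Type*} [MeasurableSpace Ω] {P : Measure Ω} {Y : ℕ → Ω → ℝ} {τ κ : ℝ}

lemma nullMeasurableSet_le_abs_stdError (h : IsStdNormalSample Y P) (d τ u : ℝ) (n : ℕ) :
    NullMeasurableSet {ω | u ≤ |stdError d τ (fun i => Y i ω) n|} P := by
  have := h.aemeasurable_sampleMean n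
  have := h.aemeasurable_sampleVar n
  refine nullMeasurableSet_le aemeasurable_const (measurable_abs.comp_aemeasurable ?_)
  unfold stdError stdMean
  fun_prop

variable [IsProbabilityMeasure P]

lemma summable_missProb (h : IsStdNormalSample Y P) (d : ℝ) (hτ : 0 < τ) (hκ : 0 < κ) {N : ℕ}
    (hN : 2 ≤ N) : Summable fun k : ℕ => missProb P Y d τ κ (k + N) := by
  obtain ⟨C, hC⟩ := h.exists_abs_missProb_sub_quadTail_le d hτ
  obtain ⟨D, hD⟩ := exists_abs_missGain_le d
  set A := 8 * (∫ z, z ^ 4 ∂γ + τ ^ 4 * ∫ z, z ^ 8 ∂γ) / κ ^ 4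
  have hle (n : ℕ) (hn : 2 ≤ n) : missProb P Y d τ κ n
      ≤ (A + τ ^ 2 / 2 * (D / κ ^ 2)) * (1 / n ^ 2) + C * (1 / (n * √n)) := by
    have hr : 1 ≤ √(n : ℝ) := Real.one_le_sqrt.2 (mod_cast (by lia : 1 ≤ n))
    have hquad : quadTail (τ / (2 * √n)) (κ * √n) 0 ≤ A * (1 / n ^ 2) := by
      calc _ ≤ 8 * (∫ z, z ^ 4 ∂γ + (τ / (2 * √n)) ^ 4 * ∫ z, z ^ 8 ∂γ) / (κ * √n) ^ 4 :=
            quadTail_zero_le _ (by positivity)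
        _ ≤ 8 * (∫ z, z ^ 4 ∂γ + τ ^ 4 * ∫ z, z ^ 8 ∂γ) / (κ * √n) ^ 4 := by
            gcongr
            exact div_le_self hτ.le (by linarith)
        _ = _ := by
            rw [mul_pow, pow_mul √(n : ℝ) 2 2, Real.sq_sqrt (by positivity), ← div_div,
              mul_one_div]
    have hgain : κ ^ 2 * missGain d (κ ^ 2 * n) ≤ D / κ ^ 2 * (1 / n ^ 2) := by
      calc _ ≤ κ ^ 2 * (D / (κ ^ 2 * n) ^ 2) := by
            gcongr
            exact (le_abs_self _).trans (hD _ (by positivity)).1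
        _ = _ := by field_simp
    have hmiss := (abs_le.1 (hC κ hκ n hn)).2
    have := mul_le_mul_of_nonneg_left hgain (by positivity : 0 ≤ τ ^ 2 / 2)
    rw [div_eq_mul_one_div C] at hmiss
    linarith
  have hsum : Summable fun n : ℕ => (A + τ ^ 2 / 2 * (D / κ ^ 2)) * (1 / (n : ℝ) ^ 2)
      + C * (1 / (n * √n)) :=
    ((Real.summable_one_div_nat_pow.2 one_lt_two).mul_left _).add
      (summable_one_div_mul_sqrt.mul_left C)
  exact ((summable_nat_add_iff N).2 hsum).of_nonneg_of_le (fun k => measureReal_nonneg)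
    fun k => hle _ (by lia)

end IsStdNormalSample

namespace IsStdNormalSample

variable {Ω : Type*} [MeasurableSpace Ω] {P : Measure Ω} {Y : ℕ → Ω → ℝ} {τ κ : ℝ}
  [IsProbabilityMeasure P]

lemma exists_abs_tsum_missProb_sub_le (h : IsStdNormalSample Y P) (d : ℝ) (hτ : 0 < τ) :
    ∃ C, ∀ κ > 0, ∀ N : ℕ, 2 ≤ N →
      |∑' k : ℕ, missProb P Y d τ κ (k + N) - ∑' k : ℕ, missProb P Y 0 τ κ (k + N)
          - τ ^ 2 / 2 * ∑' k : ℕ, κ ^ 2 * missGain d (κ ^ 2 * (k + N : ℕ))|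
        ≤ C * ∑' k : ℕ, 1 / ((k + N : ℕ) * √(k + N : ℕ)) := by
  obtain ⟨C, hC⟩ := h.exists_abs_missProb_sub_le d hτ
  refine ⟨C, fun κ hκ N hN => ?_⟩
  have hd := h.summable_missProb d hτ hκ hN
  have h0 := h.summable_missProb 0 hτ hκ hN
  have hsum : Summable fun k : ℕ => C * (1 / ((k + N : ℕ) * √(k + N : ℕ))) :=
    ((summable_nat_add_iff N).2 summable_one_div_mul_sqrt).mul_left C
  have hle (k : ℕ) : ‖missProb P Y d τ κ (k + N) - missProb P Y 0 τ κ (k + N)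
      - τ ^ 2 / 2 * (κ ^ 2 * missGain d (κ ^ 2 * (k + N : ℕ)))‖
      ≤ C * (1 / ((k + N : ℕ) * √(k + N : ℕ))) :=
    (hC κ hκ _ (by lia)).trans_eq (div_eq_mul_one_div _ _)
  have hgain : Summable fun k : ℕ => τ ^ 2 / 2 * (κ ^ 2 * missGain d (κ ^ 2 * (k + N : ℕ))) := by
    simpa only [sub_sub_cancel] using (hd.sub h0).sub (.of_norm_bounded hsum hle)
  rw [← tsum_mul_left, ← tsum_mul_left, ← hd.tsum_sub h0, ← (hd.sub h0).tsum_sub hgain]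
  exact tsum_of_norm_bounded hsum.hasSum hle

lemma tendsto_tsum_missProb_sub (h : IsStdNormalSample Y P) (d : ℝ) (hτ : 0 < τ) {ι : Type*}
    {l : Filter ι} {κ : ι → ℝ} {N : ι → ℕ} (hκ : ∀ᶠ i in l, 0 < κ i) (hN : Tendsto N l atTop)
    (hκN : Tendsto (fun i => κ i ^ 2 * N i) l (𝓝 0)) :
    Tendsto (fun i => ∑' k : ℕ, missProb P Y d τ (κ i) (k + N i)
      - ∑' k : ℕ, missProb P Y 0 τ (κ i) (k + N i)) l (𝓝 ((d ^ 2 / 4 + d / 2) * τ ^ 2)) := by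
  obtain ⟨C, hC⟩ := h.exists_abs_tsum_missProb_sub_le d hτ
  obtain ⟨D, hD⟩ := exists_abs_missGain_le d
  have hriemann : Tendsto
      (fun i => ∑' k : ℕ, κ i ^ 2 * missGain d (κ i ^ 2 * (k + N i : ℕ))) l
      (𝓝 (d ^ 2 + 2 * d - (d ^ 2 + 2 * d) / 2)) :=
    tendsto_tsum_mul_of_hasDerivAt (fun _ => hasDerivAt_missGainPrimitive d)
      (fun _ => hasDerivAt_missGain d) (fun t ht => (hD t ht).1) (fun t ht => (hD t ht).2)
      (tendsto_missGainPrimitive_zero d) (tendsto_missGainPrimitive_atTop d)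
      (hκ.mono fun _ hi => pow_pos hi 2) hN hκN
  have hrem : Tendsto (fun i => ∑' k : ℕ, missProb P Y d τ (κ i) (k + N i)
      - ∑' k : ℕ, missProb P Y 0 τ (κ i) (k + N i)
      - τ ^ 2 / 2 * ∑' k : ℕ, κ i ^ 2 * missGain d (κ i ^ 2 * (k + N i : ℕ))) l (𝓝 0) := by
    have htail : Tendsto (fun i => C * ∑' k : ℕ, 1 / ((k + N i : ℕ) * √(k + N i : ℕ) : ℝ)) l
        (𝓝 0) := by
      simpa only [mul_zero, Function.comp_apply] using
        ((tendsto_sum_nat_add fun n : ℕ => 1 / (n * √n : ℝ)).comp hN).const_mul C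
    refine squeeze_zero_norm' ?_ htail
    filter_upwards [hκ, hN.eventually_ge_atTop 2] with i hi hNi
    exact hC _ hi _ hNi
  convert! hrem.add (hriemann.const_mul (τ ^ 2 / 2)) using 2
  · ring
  · ring

end IsStdNormalSample

section AffineSample

variable (y : ℕ → ℝ) {n : ℕ}

lemma sampleMean_const_add_mul (ξ c : ℝ) (hn : 0 < n) :
    sampleMean (fun i => ξ + c * y i) n = ξ + c * sampleMean y n := by
  simp only [sampleMean, Finset.sum_add_distrib, Finset.sum_const, Finset.card_range,
    nsmul_eq_mul, ← Finset.mul_sum]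
  field_simp

lemma sampleVar_const_add_mul (ξ c : ℝ) (hn : 0 < n) :
    sampleVar (fun i => ξ + c * y i) n = c ^ 2 * sampleVar y n := by
  simp only [sampleVar, sampleMean_const_add_mul y ξ c hn, add_sub_add_left_eq_sub, ← mul_sub,
    mul_pow, ← Finset.mul_sum, mul_div_assoc]

lemma sqMeanEstimator_sub_sq (d ξ τ : ℝ) (hn : 0 < n) :
    sqMeanEstimator d (fun i => ξ + τ * ξ * y i) n - ξ ^ 2
      = 2 * τ * ξ ^ 2 / √n * stdError d τ y n := by
  have hn2 : √(n : ℝ) ^ 2 = n := Real.sq_sqrt (by positivity)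
  have : √(n : ℝ) ≠ 0 := by positivity
  rw [sqMeanEstimator, sampleMean_const_add_mul y _ _ hn, sampleVar_const_add_mul y _ _ hn,
    stdError, stdMean]
  generalize √(n : ℝ) = r at *
  rw [← hn2]
  field_simp
  ring

lemma le_abs_sqMeanEstimator_sub_sq_iff {ξ τ : ℝ} (hξ : ξ ≠ 0) (hτ : 0 < τ) (d ε : ℝ)
    (hn : 0 < n) :
    ε ≤ |sqMeanEstimator d (fun i => ξ + τ * ξ * y i) n - ξ ^ 2| ↔
      ε / (2 * τ * ξ ^ 2) * √n ≤ |stdError d τ y n| := by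
  have hscale : 0 < 2 * τ * ξ ^ 2 / √n := by positivity
  rw [sqMeanEstimator_sub_sq y d ξ τ hn, abs_mul, abs_of_pos hscale, ← div_le_iff₀' hscale,
    div_div_eq_mul_div, div_mul_eq_mul_div]

end AffineSample

/-- The smallest sample size `n ≥ 2` with `N ≤ n`. -/
noncomputable def startSize (N : ℝ) : ℕ := max 2 ⌈N⌉₊

lemma two_le_startSize (N : ℝ) : 2 ≤ startSize N := le_max_left _ _

lemma startSize_le_iff {N : ℝ} {n : ℕ} : startSize N ≤ n ↔ 2 ≤ n ∧ N ≤ n := by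
  rw [startSize, max_le_iff, Nat.ceil_le]

lemma tendsto_startSize_atTop : Tendsto startSize atTop atTop :=
  tendsto_atTop_mono (fun _ => le_max_right _ _) tendsto_nat_ceil_atTop

lemma startSize_le_add_three {N : ℝ} (hN : 0 ≤ N) : (startSize N : ℝ) ≤ N + 3 := by
  rw [startSize, Nat.cast_max, Nat.cast_ofNat]
  exact max_le (by linarith) (by linarith [Nat.ceil_lt_add_one hN])

lemma tendsto_sq_mul_startSize {a : ℝ → ℝ} (ha : Tendsto a (𝓝[>] 0) (𝓝 0))
    (ha' : Tendsto (fun ε => a ε / ε ^ 2) (𝓝[>] 0) atTop) :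
    Tendsto (fun ε : ℝ => ε ^ 2 * startSize (a ε / ε ^ 2)) (𝓝[>] 0) (𝓝 0) := by
  have hupper : Tendsto (fun ε : ℝ => a ε + ε ^ 2 * 3) (𝓝[>] 0) (𝓝 0) := by
    have hsq : Tendsto (fun ε : ℝ => ε ^ 2 * 3) (𝓝[>] 0) (𝓝 (0 ^ 2 * 3)) :=
      ((continuous_pow 2).mul_const 3).continuousWithinAt
    simpa using ha.add hsq
  refine squeeze_zero' (Eventually.of_forall fun ε => by positivity) ?_ hupper
  filter_upwards [ha'.eventually_ge_atTop 0, self_mem_nhdsWithin] with ε hnonneg (hε : 0 < ε)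
  calc ε ^ 2 * startSize (a ε / ε ^ 2) ≤ ε ^ 2 * (a ε / ε ^ 2 + 3) := by
        gcongr
        exact startSize_le_add_three hnonneg
    _ = a ε + ε ^ 2 * 3 := by field_simp

lemma missSet_const_add_mul_eq_image (y : ℕ → ℝ) {ξ τ : ℝ} (hξ : ξ ≠ 0) (hτ : 0 < τ) (d ε N : ℝ) :
    missSet d (ξ ^ 2) ε N (fun i => ξ + τ * ξ * y i) = (· + startSize N) ''
      {k : ℕ | ε / (2 * τ * ξ ^ 2) * √(k + startSize N : ℕ)
        ≤ |stdError d τ y (k + startSize N)|} := by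
  have hpos (k : ℕ) : 0 < k + startSize N := by linarith [two_le_startSize N]
  ext n
  rw [missSet, Set.mem_ofPred_eq, ← and_assoc, ← startSize_le_iff]
  constructor
  · rintro ⟨hle, hmiss⟩
    obtain ⟨k, rfl⟩ := Nat.exists_eq_add_of_le' hle
    exact ⟨k, (le_abs_sqMeanEstimator_sub_sq_iff y hξ hτ d ε (hpos k)).1 hmiss, rfl⟩
  · rintro ⟨k, hmiss, rfl⟩
    exact ⟨Nat.le_add_left _ _, (le_abs_sqMeanEstimator_sub_sq_iff y hξ hτ d ε (hpos k)).2 hmiss⟩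

lemma missCount_const_add_mul (y : ℕ → ℝ) {ξ τ : ℝ} (hξ : ξ ≠ 0) (hτ : 0 < τ) (d ε N : ℝ) :
    missCount d (ξ ^ 2) ε N (fun i => ξ + τ * ξ * y i)
      = {k : ℕ | ε / (2 * τ * ξ ^ 2) * √(k + startSize N : ℕ)
        ≤ |stdError d τ y (k + startSize N)|}.ncard := by
  rw [missCount, missSet_const_add_mul_eq_image y hξ hτ,
    Set.ncard_image_of_injective _ (add_left_injective _)]

namespace IsStdNormalSample

variable {Ω : Type*} [MeasurableSpace Ω] {P : Measure Ω} {Y : ℕ → Ω → ℝ} {ξ τ ε : ℝ}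
  [IsProbabilityMeasure P]

lemma ae_finite_missSet (h : IsStdNormalSample Y P) (hξ : ξ ≠ 0) (hτ : 0 < τ) (hε : 0 < ε)
    (d N : ℝ) : ∀ᵐ ω ∂P, (missSet d (ξ ^ 2) ε N fun i => ξ + τ * ξ * Y i ω).Finite := by
  have hκ : 0 < ε / (2 * τ * ξ ^ 2) := by positivity
  filter_upwards [ae_finite_of_summable_measureReal
    (h.summable_missProb d hτ hκ (two_le_startSize N))] with ω hfin
  rw [missSet_const_add_mul_eq_image _ hξ hτ]
  exact hfin.image _

lemma integrable_missCount (h : IsStdNormalSample Y P) (hξ : ξ ≠ 0) (hτ : 0 < τ) (hε : 0 < ε)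
    (d N : ℝ) :
    Integrable (fun ω => missCount d (ξ ^ 2) ε N fun i => ξ + τ * ξ * Y i ω) P := by
  have hκ : 0 < ε / (2 * τ * ξ ^ 2) := by positivity
  simp_rw [fun ω => missCount_const_add_mul (fun i => Y i ω) hξ hτ d ε N]
  exact integrable_ncard (fun _ => h.nullMeasurableSet_le_abs_stdError _ _ _ _)
    (h.summable_missProb d hτ hκ (two_le_startSize N))

lemma integral_missCount (h : IsStdNormalSample Y P) (hξ : ξ ≠ 0) (hτ : 0 < τ) (hε : 0 < ε)
    (d N : ℝ) :
    ∫ ω, missCount d (ξ ^ 2) ε N (fun i => ξ + τ * ξ * Y i ω) ∂P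
      = ∑' k : ℕ, missProb P Y d τ (ε / (2 * τ * ξ ^ 2)) (k + startSize N) := by
  have hκ : 0 < ε / (2 * τ * ξ ^ 2) := by positivity
  simp_rw [fun ω => missCount_const_add_mul (fun i => Y i ω) hξ hτ d ε N]
  exact integral_ncard (fun _ => h.nullMeasurableSet_le_abs_stdError _ _ _ _)
    (h.summable_missProb d hτ hκ (two_le_startSize N))

lemma tendsto_integral_missCount_sub (h : IsStdNormalSample Y P) (hξ : ξ ≠ 0) (hτ : 0 < τ)
    {a : ℝ → ℝ} (ha : Tendsto a (𝓝[>] 0) (𝓝 0))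
    (ha' : Tendsto (fun ε => a ε / ε ^ 2) (𝓝[>] 0) atTop) (d d' : ℝ) :
    Tendsto (fun ε => ∫ ω, (missCount d (ξ ^ 2) ε (a ε / ε ^ 2) (fun i => ξ + τ * ξ * Y i ω)
        - missCount d' (ξ ^ 2) ε (a ε / ε ^ 2) fun i => ξ + τ * ξ * Y i ω) ∂P) (𝓝[>] 0)
      (𝓝 ((d ^ 2 / 4 + d / 2) * τ ^ 2 - (d' ^ 2 / 4 + d' / 2) * τ ^ 2)) := by
  have hκ : ∀ᶠ ε : ℝ in 𝓝[>] 0, 0 < ε / (2 * τ * ξ ^ 2) := by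
    filter_upwards [self_mem_nhdsWithin] with ε (hε : 0 < ε)
    positivity
  have hκN : Tendsto (fun ε : ℝ => (ε / (2 * τ * ξ ^ 2)) ^ 2 * startSize (a ε / ε ^ 2)) (𝓝[>] 0)
      (𝓝 0) := by
    simpa only [zero_div, div_pow, div_mul_eq_mul_div] using
      (tendsto_sq_mul_startSize ha ha').div_const ((2 * τ * ξ ^ 2) ^ 2)
  have hlim (d : ℝ) := h.tendsto_tsum_missProb_sub d hτ hκ (tendsto_startSize_atTop.comp ha') hκN
  refine ((hlim d).sub (hlim d')).congr' ?_
  filter_upwards [self_mem_nhdsWithin] with ε (hε : 0 < ε)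
  rw [integral_sub (h.integrable_missCount hξ hτ hε d _) (h.integrable_missCount hξ hτ hε d' _),
    h.integral_missCount hξ hτ hε, h.integral_missCount hξ hτ hε]
  exact sub_sub_sub_cancel_right _ _ _

end IsStdNormalSample

section NormalSample

variable {Ω : Type*} [MeasurableSpace Ω] {P : Measure Ω} {ξ : ℝ} {σ : ℝ≥0} {X : ℕ → Ω → ℝ}

lemma isStdNormalSample_standardize (hσ : 0 < σ) {c : ℝ} (hc : c ^ 2 = σ ^ 2)
    (hindep : iIndepFun X P) (hlaw : ∀ i, HasLaw (X i) (gaussianReal ξ (σ ^ 2)) P) :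
    IsStdNormalSample (fun i ω => (X i ω - ξ) / c) P where
  indep := hindep.comp (fun _ x => (x - ξ) / c) fun _ => by fun_prop
  law i := by
    have hstd := gaussianReal_div_const (gaussianReal_sub_const (hlaw i) ξ) c
    have hvar : σ ^ 2 / NNReal.mk (c ^ 2) (sq_nonneg c) = 1 := by
      ext
      push_cast
      rw [hc]
      exact div_self (by positivity)
    rwa [sub_self, zero_div, hvar] at hstd

lemma exists_isStdNormalSample_eq (hξ : ξ ≠ 0) (hσ : 0 < σ) (hindep : iIndepFun X P)
    (hlaw : ∀ i, HasLaw (X i) (gaussianReal ξ (σ ^ 2)) P) :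
    ∃ Y, IsStdNormalSample Y P ∧ X = fun i ω => ξ + σ / |ξ| * ξ * Y i ω := by
  have : (0 : ℝ) < σ := hσ
  have hc : (σ / |ξ| * ξ) ^ 2 = (σ : ℝ) ^ 2 := by
    rw [mul_pow, div_pow, sq_abs, div_mul_cancel₀ _ (by positivity)]
  have hc0 : σ / |ξ| * ξ ≠ 0 := mul_ne_zero (by positivity) hξ
  refine ⟨_, isStdNormalSample_standardize hσ hc hindep hlaw, ?_⟩
  ext i ω
  rw [mul_div_cancel₀ _ hc0, add_sub_cancel]

end NormalSample

theorem mainTheorem5 {Ω : Type*} [MeasurableSpace Ω] (P : Measure Ω) [IsProbabilityMeasure P]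
    (ξ : ℝ) (hξ : ξ ≠ 0) (σ : ℝ≥0) (hσ : 0 < σ)
    (X : ℕ → Ω → ℝ) (hindep : iIndepFun X P)
    (hlaw : ∀ i, HasLaw (X i) (gaussianReal ξ (σ ^ 2)) P)
    (a : ℝ → ℝ) (ha : Tendsto a (𝓝[>] 0) (𝓝 0))
    (ha' : Tendsto (fun ε => a ε / ε ^ 2) (𝓝[>] 0) atTop) :
    -- the miss counts are almost surely finite, with finite expectation
    (∀ d ε : ℝ, 0 < ε →
      (∀ᵐ ω ∂P, (missSet d (ξ ^ 2) ε (a ε / ε ^ 2) (fun i => X i ω)).Finite) ∧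
      Integrable (fun ω => missCount d (ξ ^ 2) ε (a ε / ε ^ 2) (fun i => X i ω)) P) ∧
    -- the limiting expected difference
    (∀ d : ℝ, Tendsto
      (fun ε => ∫ ω, (missCount d (ξ ^ 2) ε (a ε / ε ^ 2) (fun i => X i ω)
        - missCount 0 (ξ ^ 2) ε (a ε / ε ^ 2) (fun i => X i ω)) ∂P)
      (𝓝[>] 0) (𝓝 ((1 / 4 * d ^ 2 + 1 / 2 * d) * (σ : ℝ) ^ 2 / ξ ^ 2))) ∧
    -- the choice `d = -1` is strictly better than every other choice
    (∀ d : ℝ, d ≠ -1 →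
      (1 / 4 * (-1 : ℝ) ^ 2 + 1 / 2 * (-1 : ℝ)) * (σ : ℝ) ^ 2 / ξ ^ 2
        < (1 / 4 * d ^ 2 + 1 / 2 * d) * (σ : ℝ) ^ 2 / ξ ^ 2 ∧
      Tendsto
        (fun ε => ∫ ω, (missCount d (ξ ^ 2) ε (a ε / ε ^ 2) (fun i => X i ω)
          - missCount (-1) (ξ ^ 2) ε (a ε / ε ^ 2) (fun i => X i ω)) ∂P)
        (𝓝[>] 0) (𝓝 (1 / 4 * (d + 1) ^ 2 * (σ : ℝ) ^ 2 / ξ ^ 2)) ∧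
      ∀ᶠ ε in 𝓝[>] (0 : ℝ),
        ∫ ω, missCount (-1) (ξ ^ 2) ε (a ε / ε ^ 2) (fun i => X i ω) ∂P
          < ∫ ω, missCount d (ξ ^ 2) ε (a ε / ε ^ 2) (fun i => X i ω) ∂P) := by
  have hτ : 0 < (σ : ℝ) / |ξ| := div_pos hσ (abs_pos.2 hξ)
  have hτ2 : ((σ : ℝ) / |ξ|) ^ 2 = σ ^ 2 / ξ ^ 2 := by rw [div_pow, sq_abs]
  obtain ⟨Y, hY, rfl⟩ := exists_isStdNormalSample_eq hξ hσ hindep hlaw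
  have hint {ε : ℝ} (hε : 0 < ε) (d : ℝ) := hY.integrable_missCount hξ hτ hε d (a ε / ε ^ 2)
  have hlim := hY.tendsto_integral_missCount_sub hξ hτ ha ha'
  refine ⟨fun d ε hε => ⟨hY.ae_finite_missSet hξ hτ hε d _, hint hε d⟩, fun d => ?_,
    fun d hd => ?_⟩
  · convert! hlim d 0 using 2
    rw [hτ2]
    ring
  · have hgap : (d ^ 2 / 4 + d / 2) * (σ / |ξ|) ^ 2 - ((-1) ^ 2 / 4 + -1 / 2) * (σ / |ξ|) ^ 2
        = 1 / 4 * (d + 1) ^ 2 * (σ : ℝ) ^ 2 / ξ ^ 2 := by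
      rw [hτ2]
      ring
    have hpos : 0 < 1 / 4 * (d + 1) ^ 2 * (σ : ℝ) ^ 2 / ξ ^ 2 := by
      have : d + 1 ≠ 0 := fun h => hd (eq_neg_of_add_eq_zero_left h)
      have : (0 : ℝ) < σ := hσ
      positivity
    have hlim' := hgap ▸ hlim d (-1)
    refine ⟨sub_pos.1 (hpos.trans_eq (by ring)), hlim', ?_⟩
    filter_upwards [hlim'.eventually_const_lt hpos, self_mem_nhdsWithin] with ε hlt (hε : 0 < ε)
    rwa [integral_sub (hint hε d) (hint hε (-1)), sub_pos] at hlt
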